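/- Let $\Lambda$ be a discrete valuation ring with maximal ideal generated by $p$. For a partition $\alpha=(\alpha_1\ge\alpha_2\ge\cdots)$ put $N_\alpha=\bigoplus_j\Lambda/(p^{\alpha_j})$, and let $\alpha'$ be the conjugate partition. An embedding $f:A\to B$ of finite length $\Lambda$-modules is a direct sum of cyclic embeddings if there are finite decompositions $A=\bigoplus_k A_k$, $B=\bigoplus_k B_k$ with $f(A_k)\subseteq B_k$ and each $A_k$ a cyclic module (possibly zero). Young diagrams are drawn with the parts of the partition as the lengths of the columns. A tableau is an increasing sequence of partitions $\Gamma=[\gamma^{(0)}\subseteq\gamma^{(1)}\subseteq\cdots\subseteq\gamma^{(r)}]$, continued by $\gamma^{(i)}=\gamma^{(r)}$ for $i\ge r$; the boxes in $\gamma^{(e)}\setminus\gamma^{(e-1)}$ carry the entry $e$. Its shape is $\beta\setminus\gamma$ with $\beta=\gamma^{(r)}$, $\gamma=\gamma^{(0)}$, and its content is the partition $\alpha$ such that $\alpha'_e$ is the number of entries $e$, for all $e\ge1$. It is an LR-tableau if entries increase weakly along each row and strictly down each column, and if for each column and each $e\ge 1$, there are in this column and the columns to its right at least as many entries $e$ as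 entries $e+1$. The union of tableaux is obtained by taking for each $i$ the union, as multisets of parts, of their $i$-th partitions. A column is a tableau $C(e,f)_n$ with only one column, of height $n$, whose non-empty boxes are at the bottom and carry the consecutive entries $e,e+1,\ldots,f$ with $1\le e\le f$ and $n\ge f-e+1$, or the empty column of height $n$ without entries. The tableau of an embedding $f:A\to B$ is the one for which $B/p^if(A)\cong N_{\gamma^{(i)}}$ for all $i\ge 0$. The skew diagram $\beta\setminus\gamma$ (where $\gamma\subseteq\beta$) is a horizontal strip if it has at most one box in each column. 1. For all partitions $\alpha,\beta,\gamma$, there is an embedding $N_\alpha\to N_\beta$ with cokernel isomorphic to $N_\gamma$ which is a direct sum of cyclic embeddings if and only if there is an LR-tableau of shape $\beta\setminus\gamma$ and content $\alpha$ which is a (finite) union of columns. 2. Let $\beta\setminus\gamma$ be a horizontal strip. Then for every partition $\alpha$ and every LR-tableau $\Gamma$ of shape $\beta\setminus\gamma$ and content $\alpha$, there is an embedding $N_\alpha\to N_\beta$ with cokernel isomorphic to $N_\gamma$ which is a direct sum of cyclic embeddings and has tableau $\Gamma$. In particular, there are a partition $\alpha$ and an embedding $N_\alpha\to N_\beta$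 with cokernel isomorphic to $N_\gamma$ which is a direct sum of cyclic embeddings. -/

import Mathlib

universe u

/-! A partition is represented by the Young diagram whose *columns* are its parts:
the parts of `α` are `α.colLen 0 ≥ α.colLen 1 ≥ ⋯`, one for each of its `α.rowLen 0` columns,
and the parts of the conjugate partition are `α.rowLen 0 ≥ α.rowLen 1 ≥ ⋯`.
A box is a pair (row, column), numbered from zero, rows from top to bottom and
columns from left to right. -/

/-- The multiset of (positive) parts of a partition. -/
def partitionParts (α : YoungDiagram) : Multiset ℕ :=
  (Multiset.range (α.rowLen 0)).map α.colLen

/-- The partition with the single part `h` (the empty partition if `h = 0`). -/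
def singlePart (h : ℕ) : YoungDiagram where
  cells := Finset.range h ×ˢ {0}
  isLowerSet := by
    rintro ⟨i, j⟩ ⟨i', j'⟩ hle hmem
    have h1 : i' ≤ i := hle.1
    have h2 : j' ≤ j := hle.2
    simp only [Finset.coe_product, Finset.coe_range, Finset.coe_singleton, Set.mem_prod,
      Set.mem_Iio, Set.mem_singleton_iff] at hmem ⊢
    omega

/-- A tableau `[γ⁽⁰⁾, γ⁽¹⁾, …, γ⁽ʳ⁾]`: an increasing sequence of partitions, continued by
`γ⁽ⁱ⁾ = γ⁽ʳ⁾` for `i ≥ r`. -/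
@[ext]
structure Tableau where
  part : ℕ → YoungDiagram
  mono : Monotone part
  stable : ∃ r, ∀ i, r ≤ i → part i = part r

namespace Tableau

/-- The boxes that carry the entry `e`: those of the skew diagram `γ⁽ᵉ⁾ ∖ γ⁽ᵉ⁻¹⁾`
(there are none for `e = 0`). -/
def boxes (Γ : Tableau) (e : ℕ) : Finset (ℕ × ℕ) :=
  (Γ.part e).cells \ (Γ.part (e - 1)).cells

/-- The tableau has shape `β ∖ γ`. -/
def HasShape (Γ : Tableau) (β γ : YoungDiagram) : Prop :=
  Γ.part 0 = γ ∧ ∃ r, ∀ i, r ≤ i → Γ.part i = β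

/-- The tableau has content `α`: the number of entries `e` is the `e`-th part of the
conjugate of `α`, for all `e ≥ 1`. -/
def HasContent (Γ : Tableau) (α : YoungDiagram) : Prop :=
  ∀ e : ℕ, 1 ≤ e → (Γ.boxes e).card = α.rowLen (e - 1)

/-- The Littlewood-Richardson condition. -/
structure IsLR (Γ : Tableau) : Prop where
  /-- in each row, the entries are weakly increasing -/
  row_weak : ∀ d e i j j' : ℕ, (i, j) ∈ Γ.boxes d → (i, j') ∈ Γ.boxes e → j < j' → d ≤ e
  /-- in each column, the entries are strictly increasing -/
  col_strict : ∀ d e i i' j : ℕ, (i, j) ∈ Γ.boxes d → (i', j) ∈ Γ.boxes e → i < i' → d < e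
  /-- from each column on to the right, there are at least as many entries `e` as `e + 1` -/
  lattice : ∀ e j : ℕ, 1 ≤ e →
    ((Γ.boxes (e + 1)).filter (fun c => j ≤ c.2)).card ≤
      ((Γ.boxes e).filter (fun c => j ≤ c.2)).card

/-- The one-column tableau `C(e,f)_n` of height `n` with entries `e, …, f` at the bottom:
the height of `γ⁽ⁱ⁾` is `n - f + e - 1` for `i < e`, it is `n - f + i` for `e ≤ i ≤ f`,
and `n` for `i ≥ f`. -/
def column (e f n : ℕ) : Tableau where
  part i := singlePart (n - (f - max (e - 1) (min i f)))
  mono := by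
    rintro i i' hi ⟨a, b⟩ hc
    simp only [singlePart, ← YoungDiagram.mem_cells,
      Finset.mem_product, Finset.mem_range, Finset.mem_singleton] at hc ⊢
    omega
  stable := ⟨f, fun i hi => by simp [hi]⟩

/-- Column tableaux: `C(e,f)_n` with `1 ≤ e ≤ f` and `n ≥ f - e + 1`, and the empty columns
`C(1,0)_n`. -/
def IsColumn (Γ : Tableau) : Prop :=
  (∃ n, Γ = column 1 0 n) ∨ ∃ e f n, 1 ≤ e ∧ e ≤ f ∧ f + 1 ≤ n + e ∧ Γ = column e f n

/-- `Γ` is the union of the tableaux `C 0, …, C (m - 1)`: each partition `γ⁽ⁱ⁾` is the union,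
with multiplicities, of the corresponding partitions of the `C k`. -/
def IsUnion (Γ : Tableau) {m : ℕ} (C : Fin m → Tableau) : Prop :=
  ∀ i, partitionParts (Γ.part i) = ∑ k, partitionParts ((C k).part i)

/-- `Γ` is a (finite) union of columns. -/
def IsUnionOfColumns (Γ : Tableau) : Prop :=
  ∃ (m : ℕ) (C : Fin m → Tableau), (∀ k, (C k).IsColumn) ∧ Γ.IsUnion C

end Tableau

/-- The skew diagram `β ∖ γ` is defined and is a horizontal strip: it has at most one box in
each column. -/
def IsHorizontalStrip (β γ : YoungDiagram) : Prop :=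
  γ ≤ β ∧ ∀ i i' j : ℕ, (i, j) ∈ β.cells \ γ.cells → (i', j) ∈ β.cells \ γ.cells → i = i'

/-- The module `N_α = ⨁ⱼ Λ/(p^{αⱼ})`. -/
abbrev NMod {Λ : Type u} [CommRing Λ] (p : Λ) (α : YoungDiagram) : Type u :=
  (j : Fin (α.rowLen 0)) → Λ ⧸ Ideal.span {p ^ α.colLen j}

section Embeddings

variable {Λ : Type u} [CommRing Λ] {A B : Type u} [AddCommGroup A] [Module Λ A]
  [AddCommGroup B] [Module Λ B]

/-- The embedding `f : A → B` is a finite direct sum of cyclic embeddings: there are direct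
decompositions `A = ⨁ Aₖ`, `B = ⨁ Bₖ` such that `f` restricts to `Aₖ → Bₖ` and such that each
`Aₖ` is a cyclic module (possibly zero). -/
def IsDirectSumOfCyclicEmbeddings (f : A →ₗ[Λ] B) : Prop :=
  ∃ (m : ℕ) (A' : Fin m → Submodule Λ A) (B' : Fin m → Submodule Λ B),
    DirectSum.IsInternal A' ∧ DirectSum.IsInternal B' ∧
      ∀ k, (A' k).map f ≤ B' k ∧ (A' k).IsPrincipal

/-- `Γ` is the tableau of the embedding `f : A → B`: its `i`-th partition is the type of the
module `B / pⁱ f(A)`. -/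
def IsTableauOf (p : Λ) (f : A →ₗ[Λ] B) (Γ : Tableau) : Prop :=
  ∀ i : ℕ, Nonempty ((B ⧸ LinearMap.range ((p ^ i) • f)) ≃ₗ[Λ] NMod p (Γ.part i))

end Embeddings

/-- `f` is an embedding `N_α → N_β` with cokernel isomorphic to `N_γ`, and it is a direct sum
of cyclic embeddings. -/
def IsCyclicSumEmbeddingOfType {Λ : Type u} [CommRing Λ] (p : Λ) (α β γ : YoungDiagram)
    (f : NMod p α →ₗ[Λ] NMod p β) : Prop :=
  Function.Injective f ∧ Nonempty ((NMod p β ⧸ LinearMap.range f) ≃ₗ[Λ] NMod p γ) ∧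
    IsDirectSumOfCyclicEmbeddings f

/-! A cyclic embedding is determined by the image `b` of a generator. Since `Λ` is a discrete
valuation ring, scaling coordinates by units and sorting them turns `b` into `(p ^ x)` in `⨁ Λ/(p ^
(x + l))` with `x` increasing; call this a pole (`exists_equiv_poleGenerator`). Splitting off the
coordinate with the smallest `x` computes `B/(pⁱb)`: the coordinate leaves height `x + min i l`, and
the remaining generator is multiplied by `p ^ max i l`. Hence the tableau of a pole is a union of
columns: a coordinate whose `l` exceeds the maximum `m` of the earlier ones carries the entries `m +
1, …, l`, and every other coordinate gives an empty column.

The Littlewood-Richardson condition can be expressed by inequalities between numbers of boxes in the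
first rows. These add up over unions, so it suffices to check them for one pole
(`truncSum_poleHeights_lattice`). Together with uniqueness of types this turns a direct sum of
cyclic embeddings into an LR-tableau.

Conversely, in a union of columns all boxes cancel from the row inequality except first and last
entries of columns: columns starting with `e + 1` are dominated by columns ending with `e`, also
when only those with height minus last entry at most `y` are counted. A greedy matching then chains
the columns into poles (`exists_poles_of_columnsMatch`), and the poles are realized by embeddings
(`exists_embedding_of_poles`).

In a horizontal strip each column has at most one box, so every tableau of that shape is a union of
columns. -/

/-! ### Partitions as multisets of parts, and their rows -/

lemma multiset_filter_sum {ι : Type*} (S : Finset ι) (f : ι → Multiset ℕ) (q : ℕ → Prop)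
    [DecidablePred q] : (∑ k ∈ S, f k).filter q = ∑ k ∈ S, (f k).filter q :=
  map_sum (⟨⟨Multiset.filter q, rfl⟩, Multiset.filter_add q⟩ : Multiset ℕ →+ Multiset ℕ) _ _

/-- The number of parts greater than `i`: the length of the `i`-th row of the diagram. -/
def rowCount (s : Multiset ℕ) (i : ℕ) : ℕ := s.countP (i < ·)

/-- The number of boxes in the first `r` rows of the diagram with parts `s`. -/
def truncSum (s : Multiset ℕ) (r : ℕ) : ℕ := (s.map (min · r)).sum

@[simp] lemma rowCount_zero (i : ℕ) : rowCount 0 i = 0 := rfl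

lemma rowCount_cons (h : ℕ) (s : Multiset ℕ) (i : ℕ) :
    rowCount (h ::ₘ s) i = rowCount s i + if i < h then 1 else 0 := by
  simp [rowCount, Multiset.countP_cons]

lemma rowCount_add (s t : Multiset ℕ) (i : ℕ) :
    rowCount (s + t) i = rowCount s i + rowCount t i := by
  simp [rowCount]

lemma rowCount_sum {ι : Type*} (S : Finset ι) (f : ι → Multiset ℕ) (i : ℕ) :
    rowCount (∑ k ∈ S, f k) i = ∑ k ∈ S, rowCount (f k) i := by
  classical
  induction S using Finset.induction_on with
  | empty => simp
  | insert a S ha ih => rw [Finset.sum_insert ha, Finset.sum_insert ha, rowCount_add, ih]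

lemma rowCount_antitone (s : Multiset ℕ) : Antitone (rowCount s) := by
  intro i j hij
  induction s using Multiset.induction_on with
  | empty => simp
  | cons h s ih =>
    rw [rowCount_cons, rowCount_cons]
    split_ifs <;> omega

@[simp] lemma truncSum_zero (r : ℕ) : truncSum 0 r = 0 := rfl

lemma truncSum_cons (h : ℕ) (s : Multiset ℕ) (r : ℕ) :
    truncSum (h ::ₘ s) r = min h r + truncSum s r := by
  simp [truncSum]

lemma truncSum_add (s t : Multiset ℕ) (r : ℕ) :
    truncSum (s + t) r = truncSum s r + truncSum t r := by
  simp [truncSum]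

lemma truncSum_sum {ι : Type*} (S : Finset ι) (f : ι → Multiset ℕ) (r : ℕ) :
    truncSum (∑ k ∈ S, f k) r = ∑ k ∈ S, truncSum (f k) r := by
  classical
  induction S using Finset.induction_on with
  | empty => simp
  | insert a S ha ih => rw [Finset.sum_insert ha, Finset.sum_insert ha, truncSum_add, ih]

lemma truncSum_succ (s : Multiset ℕ) (r : ℕ) :
    truncSum s (r + 1) = truncSum s r + rowCount s r := by
  induction s using Multiset.induction_on with
  | empty => simp
  | cons h s ih =>
    rw [rowCount_cons, truncSum_cons, truncSum_cons, ih]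
    split_ifs <;> omega

lemma truncSum_eq_sum_rowCount (s : Multiset ℕ) (r : ℕ) :
    truncSum s r = ∑ i ∈ Finset.range r, rowCount s i := by
  induction r with
  | zero => simp [truncSum]
  | succ r ih => rw [truncSum_succ, Finset.sum_range_succ, ih]

lemma rowCount_eq_of_truncSum_eq {s t : Multiset ℕ} (h : ∀ r, truncSum s r = truncSum t r)
    (i : ℕ) : rowCount s i = rowCount t i := by
  have h1 := h i
  have h2 := h (i + 1)
  rw [truncSum_succ, truncSum_succ] at h2
  omega

lemma count_add_rowCount (s : Multiset ℕ) (n : ℕ) :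
    s.count (n + 1) + rowCount s (n + 1) = rowCount s n := by
  induction s using Multiset.induction_on with
  | empty => simp
  | cons h s ih =>
    rw [rowCount_cons, rowCount_cons, Multiset.count_cons]
    split_ifs <;> omega

lemma rowCount_filter_pos (s : Multiset ℕ) (i : ℕ) :
    rowCount (s.filter (0 < ·)) i = rowCount s i := by
  simp only [rowCount, Multiset.countP_filter]
  exact Multiset.countP_congr rfl fun x _ => by simpa using fun h => by omega

/-- The positive parts of a partition are determined by its rows. -/
lemma filter_pos_eq_of_rowCount_eq {s t : Multiset ℕ} (h : ∀ i, rowCount s i = rowCount t i) :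
    s.filter (0 < ·) = t.filter (0 < ·) := by
  ext n
  rcases n with _ | n
  · simp
  · have h1 := count_add_rowCount s n
    have h2 := count_add_rowCount t n
    rw [h, h] at h1
    rw [Multiset.count_filter_of_pos (by omega), Multiset.count_filter_of_pos (by omega)]
    omega

lemma YoungDiagram.ext_rowLen {α β : YoungDiagram} (h : ∀ i, α.rowLen i = β.rowLen i) :
    α = β := by
  ext ⟨i, j⟩
  rw [mem_cells, mem_cells, mem_iff_lt_rowLen, mem_iff_lt_rowLen, h]

lemma YoungDiagram.le_iff_rowLen {α β : YoungDiagram} :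
    α ≤ β ↔ ∀ i, α.rowLen i ≤ β.rowLen i := by
  constructor
  · intro h i
    by_contra! hlt
    exact lt_irrefl _ (mem_iff_lt_rowLen.1 (h (mem_iff_lt_rowLen.2 hlt)))
  · rintro h ⟨i, j⟩ hc
    exact mem_iff_lt_rowLen.2 ((mem_iff_lt_rowLen.1 hc).trans_le (h i))

lemma countP_range_lt (m n : ℕ) (h : n ≤ m) : (Multiset.range m).countP (· < n) = n := by
  have : (Multiset.range m).filter (· < n) = Multiset.range n := by
    ext a
    simp only [Multiset.count_filter, Multiset.count_eq_of_nodup (Multiset.nodup_range _),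
      Multiset.mem_range]
    split_ifs <;> omega
  rw [Multiset.countP_eq_card_filter, this, Multiset.card_range]

lemma rowCount_map_colLen (α : YoungDiagram) {m : ℕ} (hm : α.rowLen 0 ≤ m) (i : ℕ) :
    rowCount ((Multiset.range m).map α.colLen) i = α.rowLen i := by
  rw [rowCount, Multiset.countP_map, ← Multiset.countP_eq_card_filter]
  rw [← countP_range_lt m (α.rowLen i) ((α.rowLen_anti 0 i (Nat.zero_le _)).trans hm)]
  refine Multiset.countP_congr rfl fun j _ => ?_
  rw [← YoungDiagram.mem_iff_lt_colLen, YoungDiagram.mem_iff_lt_rowLen]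

@[simp] lemma rowCount_partitionParts (α : YoungDiagram) (i : ℕ) :
    rowCount (partitionParts α) i = α.rowLen i :=
  rowCount_map_colLen α le_rfl i

lemma partitionParts_pos {α : YoungDiagram} {h : ℕ} (hh : h ∈ partitionParts α) : 0 < h := by
  obtain ⟨j, hj, rfl⟩ := Multiset.mem_map.1 hh
  rw [← YoungDiagram.mem_iff_lt_colLen, YoungDiagram.mem_iff_lt_rowLen]
  exact Multiset.mem_range.1 hj

lemma partitionParts_eq_iff {α : YoungDiagram} {s : Multiset ℕ} :
    partitionParts α = s.filter (0 < ·) ↔ ∀ i, α.rowLen i = rowCount s i := by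
  constructor
  · intro h i
    rw [← rowCount_partitionParts, h, rowCount_filter_pos]
  · intro h
    rw [← filter_pos_eq_of_rowCount_eq (s := partitionParts α) (by simpa using h)]
    exact (Multiset.filter_eq_self.2 fun _ => partitionParts_pos).symm

/-- The partition whose positive parts are those of the multiset `s`. -/
def ofParts (s : Multiset ℕ) : YoungDiagram where
  cells := (Finset.range s.sum ×ˢ Finset.range s.card).filter fun c => c.2 < rowCount s c.1
  isLowerSet := by
    rintro ⟨i, j⟩ ⟨i', j'⟩ ⟨h1 : i' ≤ i, h2 : j' ≤ j⟩ hmem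
    have := rowCount_antitone s h1
    simp only [Finset.coe_filter, Finset.mem_product, Finset.mem_range, Set.mem_ofPred_eq]
      at hmem ⊢
    omega

lemma mem_ofParts {s : Multiset ℕ} {i j : ℕ} : (i, j) ∈ ofParts s ↔ j < rowCount s i := by
  rw [← YoungDiagram.mem_cells]
  simp only [ofParts, Finset.mem_filter, Finset.mem_product, Finset.mem_range, and_iff_right_iff_imp]
  intro h
  refine ⟨?_, h.trans_le (Multiset.countP_le_card _ _)⟩
  obtain ⟨a, ha, hia⟩ := Multiset.countP_pos.1 ((Nat.zero_le _).trans_lt h)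
  exact hia.trans_le (Multiset.le_sum_of_mem ha)

@[simp] lemma rowLen_ofParts (s : Multiset ℕ) (i : ℕ) :
    (ofParts s).rowLen i = rowCount s i := by
  refine eq_of_forall_lt_iff fun j => ?_
  rw [← YoungDiagram.mem_iff_lt_rowLen, mem_ofParts]

lemma partitionParts_ofParts (s : Multiset ℕ) :
    partitionParts (ofParts s) = s.filter (0 < ·) :=
  partitionParts_eq_iff.2 (rowLen_ofParts s)

lemma rowLen_singlePart (h i : ℕ) : (singlePart h).rowLen i = if i < h then 1 else 0 := by
  refine eq_of_forall_lt_iff fun j => ?_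
  rw [← YoungDiagram.mem_iff_lt_rowLen, ← YoungDiagram.mem_cells]
  simp only [singlePart, Finset.mem_product, Finset.mem_range, Finset.mem_singleton]
  split_ifs <;> omega

lemma partitionParts_singlePart (h : ℕ) :
    partitionParts (singlePart h) = ({h} : Multiset ℕ).filter (0 < ·) := by
  refine partitionParts_eq_iff.2 fun i => ?_
  rw [rowLen_singlePart, ← Multiset.cons_zero, rowCount_cons]
  simp

open YoungDiagram in
lemma card_filter_fst_lt (μ : YoungDiagram) (r : ℕ) :
    (μ.cells.filter (·.1 < r)).card = truncSum (partitionParts μ) r := by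
  rw [truncSum_eq_sum_rowCount]
  have : μ.cells.filter (·.1 < r) = (Finset.range r).biUnion μ.row := by
    ext ⟨i, j⟩
    simp [mem_row_iff, and_comm]
  rw [this, Finset.card_biUnion]
  · simp [rowLen_eq_card]
  · intro a _ b _ hab
    rw [Function.onFun, Finset.disjoint_left]
    intro c hc hd
    exact hab ((mem_row_iff.1 hc).2.symm.trans (mem_row_iff.1 hd).2)

/-! ### The Littlewood-Richardson condition in terms of rows -/

namespace Tableau

variable {Γ : Tableau}

lemma mem_boxes {e i j : ℕ} :
    (i, j) ∈ Γ.boxes e ↔ (Γ.part (e - 1)).rowLen i ≤ j ∧ j < (Γ.part e).rowLen i := by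
  rw [boxes, Finset.mem_sdiff, YoungDiagram.mem_cells, YoungDiagram.mem_cells,
    YoungDiagram.mem_iff_lt_rowLen, YoungDiagram.mem_iff_lt_rowLen]
  omega

lemma rowLen_mono (Γ : Tableau) (i : ℕ) {d e : ℕ} (h : d ≤ e) :
    (Γ.part d).rowLen i ≤ (Γ.part e).rowLen i :=
  YoungDiagram.le_iff_rowLen.1 (Γ.mono h) i

lemma card_boxes_filter_fst_lt (Γ : Tableau) (e r : ℕ) :
    ((Γ.boxes e).filter (·.1 < r)).card + truncSum (partitionParts (Γ.part (e - 1))) r =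
      truncSum (partitionParts (Γ.part e)) r := by
  rw [← card_filter_fst_lt, ← card_filter_fst_lt, boxes,
    show ((Γ.part e).cells \ (Γ.part (e - 1)).cells).filter (·.1 < r) =
      (Γ.part e).cells.filter (·.1 < r) \ (Γ.part (e - 1)).cells.filter (·.1 < r) by
        ext; simp only [Finset.mem_filter, Finset.mem_sdiff]; tauto]
  exact Finset.card_sdiff_add_card_eq_card
    (Finset.filter_subset_filter _ (YoungDiagram.cells_subset_iff.2 (Γ.mono (Nat.sub_le e 1))))

/-- In an LR-tableau, the first `r + 1` rows contain at most as many entries `e + 1`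
as the first `r` rows contain entries `e`. -/
lemma IsLR.card_rows_le (h : Γ.IsLR) {e : ℕ} (he : 1 ≤ e) (r : ℕ) :
    ((Γ.boxes (e + 1)).filter (·.1 < r + 1)).card ≤ ((Γ.boxes e).filter (·.1 < r)).card := by
  -- Cut at the column where row `r` of `γ⁽ᵉ⁾` ends: entries `e + 1` in rows up to `r` lie on or to
  -- the right of it, and entries `e` there lie strictly above row `r`.
  refine (Finset.card_le_card ?_).trans
    ((h.lattice e ((Γ.part e).rowLen r) he).trans (Finset.card_le_card ?_))
  · rintro ⟨i, j⟩ hc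
    rw [Finset.mem_filter, mem_boxes] at hc ⊢
    refine ⟨hc.1, le_trans ?_ hc.1.1⟩
    exact (Γ.part e).rowLen_anti i r (by have := hc.2; dsimp at this; omega)
  · rintro ⟨i, j⟩ hc
    rw [Finset.mem_filter, mem_boxes] at hc ⊢
    refine ⟨hc.1, ?_⟩
    by_contra! hr
    have := (Γ.part e).rowLen_anti r i hr
    have := hc.2
    dsimp at this
    omega

lemma IsLR.truncSum_le (h : Γ.IsLR) {e : ℕ} (he : 1 ≤ e) (r : ℕ) :
    truncSum (partitionParts (Γ.part (e + 1))) (r + 1) +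
        truncSum (partitionParts (Γ.part (e - 1))) r ≤
      truncSum (partitionParts (Γ.part e)) (r + 1) + truncSum (partitionParts (Γ.part e)) r := by
  have h1 := h.card_rows_le he r
  have h2 := Γ.card_boxes_filter_fst_lt (e + 1) (r + 1)
  have h3 := Γ.card_boxes_filter_fst_lt e r
  rw [Nat.add_sub_cancel] at h2
  omega

/-- Let `r` be the height of column `j` in `γ⁽ᵉ⁾`. By `hs`, entries `e + 1` from column `j` on lie
in rows up to `r`. If the cut at `j` keeps all entries `e` in the first `r` rows, `hl` at `r`
suffices. Otherwise it cuts through the entries `e` of row `r - 1`: the rows above are compared by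
`hl` at `r - 1`, and the cut rows `r - 1` and `r` by `hs`. -/
lemma lattice_of_rows
    (hs : ∀ e r, (Γ.part (e + 1)).rowLen (r + 1) ≤ (Γ.part e).rowLen r)
    (hl : ∀ e r, 1 ≤ e →
      ((Γ.boxes (e + 1)).filter (·.1 < r + 1)).card ≤ ((Γ.boxes e).filter (·.1 < r)).card)
    {e : ℕ} (he : 1 ≤ e) (j : ℕ) :
    ((Γ.boxes (e + 1)).filter (fun c => j ≤ c.2)).card ≤
      ((Γ.boxes e).filter (fun c => j ≤ c.2)).card := by
  obtain ⟨r, hr⟩ : ∃ r, ∀ i, r ≤ i ↔ (Γ.part e).rowLen i ≤ j := by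
    refine ⟨(Γ.part e).colLen j, fun i => ?_⟩
    rw [← not_lt, ← not_lt, not_iff_not, ← YoungDiagram.mem_iff_lt_colLen,
      YoungDiagram.mem_iff_lt_rowLen]
  have hsub : (Γ.boxes (e + 1)).filter (fun c => j ≤ c.2) ⊆
      (Γ.boxes (e + 1)).filter (·.1 < r + 1) := by
    rintro ⟨i, k⟩ hc
    rw [Finset.mem_filter, mem_boxes] at hc ⊢
    refine ⟨hc.1, ?_⟩
    by_contra! hi
    obtain ⟨i, rfl⟩ : ∃ i', i = i' + 1 := ⟨i - 1, by dsimp at hi; omega⟩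
    have h1 := hs e i
    have h2 := (hr i).1 (by dsimp at hi; omega)
    have h3 := hc.2
    dsimp at h3
    omega
  rcases r with _ | q
  · refine (Finset.card_le_card hsub).trans ((hl e 0 he).trans ?_)
    simp
  have hq : j < (Γ.part e).rowLen q := by
    by_contra! h
    have := (hr q).2 h
    omega
  rcases le_total j ((Γ.part (e - 1)).rowLen q) with hj | hj
  · refine (Finset.card_le_card hsub).trans ((hl e (q + 1) he).trans (Finset.card_le_card ?_))
    rintro ⟨i, k⟩ hc
    rw [Finset.mem_filter, mem_boxes] at hc ⊢
    refine ⟨hc.1, hj.trans (le_trans ?_ hc.1.1)⟩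
    exact (Γ.part (e - 1)).rowLen_anti i q (by have := hc.2; dsimp at this; omega)
  · have h1 : (Γ.boxes (e + 1)).filter (fun c => j ≤ c.2) ⊆
        (Γ.boxes (e + 1)).filter (·.1 < q + 1) ∪
          ({q + 1} ×ˢ Finset.Ico j ((Γ.part (e + 1)).rowLen (q + 1))) := by
      rintro ⟨i, k⟩ hc
      have hlt := (Finset.mem_filter.1 (hsub hc)).2
      rw [Finset.mem_filter, mem_boxes] at hc
      rw [Finset.mem_union, Finset.mem_filter, mem_boxes, Finset.mem_product,
        Finset.mem_singleton, Finset.mem_Ico]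
      dsimp at hlt hc ⊢
      rcases (show i < q + 1 ∨ i = q + 1 by omega) with h | rfl
      · exact Or.inl ⟨hc.1, h⟩
      · exact Or.inr ⟨rfl, hc.2, hc.1.2⟩
    have h2 : (Γ.boxes e).filter (·.1 < q) ∪
          ({q} ×ˢ Finset.Ico j ((Γ.part e).rowLen q)) ⊆
        (Γ.boxes e).filter (fun c => j ≤ c.2) := by
      rintro ⟨i, k⟩ hc
      rw [Finset.mem_union, Finset.mem_filter, mem_boxes, Finset.mem_product,
        Finset.mem_singleton, Finset.mem_Ico] at hc
      rw [Finset.mem_filter, mem_boxes]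
      dsimp at hc ⊢
      rcases hc with ⟨hc, hi⟩ | ⟨rfl, hc⟩
      -- In the rows above `q`, `hs` for `e - 1` pushes every entry `e` beyond the end of row `q` of
      -- `γ⁽ᵉ⁾`, hence beyond column `j`.
      · refine ⟨hc, ?_⟩
        have h3 := hs (e - 1) i
        rw [Nat.sub_add_cancel he] at h3
        have h4 := (Γ.part e).rowLen_anti (i + 1) q hi
        omega
      · omega
    have h3 := Finset.card_le_card h2
    rw [Finset.card_union_of_disjoint] at h3
    · have h4 := (Finset.card_le_card h1).trans (Finset.card_union_le _ _)
      rw [Finset.card_product, Finset.card_singleton, Nat.card_Ico, one_mul] at h3 h4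
      have h5 := hl e q he
      have h6 := hs e q
      omega
    · rw [Finset.disjoint_left]
      rintro ⟨i, k⟩ hc hd
      have h4 := (Finset.mem_filter.1 hc).2
      have h5 := (Finset.mem_product.1 hd).1
      rw [Finset.mem_singleton] at h5
      dsimp at h4 h5
      omega

/-- Both hypotheses are linear inequalities in row lengths, so they can be verified on the pieces of
a union and added. The first gives strictness in columns; weak increase in rows is automatic. -/
lemma isLR_of_rows
    (hs : ∀ e r, (Γ.part (e + 1)).rowLen (r + 1) ≤ (Γ.part e).rowLen r)
    (hl : ∀ e r, 1 ≤ e →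
      truncSum (partitionParts (Γ.part (e + 1))) (r + 1) +
          truncSum (partitionParts (Γ.part (e - 1))) r ≤
        truncSum (partitionParts (Γ.part e)) (r + 1) + truncSum (partitionParts (Γ.part e)) r) :
    Γ.IsLR where
  row_weak d e i j j' hd he hj := by
    rw [mem_boxes] at hd he
    by_contra! hlt
    have := Γ.rowLen_mono i (show e ≤ d - 1 by omega)
    omega
  col_strict d e i i' j hd he hi := by
    rw [mem_boxes] at hd he
    by_contra! hlt
    rcases Nat.eq_zero_or_pos d with rfl | hd0
    · dsimp at hd
      omega
    have h1 := Γ.rowLen_mono i' hlt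
    have h2 := hs (d - 1) i
    rw [Nat.sub_add_cancel hd0] at h2
    have h3 := (Γ.part d).rowLen_anti (i + 1) i' hi
    omega
  lattice e j he := by
    refine lattice_of_rows hs (fun e r he => ?_) he j
    have h1 := hl e r he
    have h2 := Γ.card_boxes_filter_fst_lt (e + 1) (r + 1)
    have h3 := Γ.card_boxes_filter_fst_lt e r
    rw [Nat.add_sub_cancel] at h2
    omega

end Tableau

/-! ### Combinatorics of a single pole -/

/-- The heights of the columns of the `i`-th partition of the tableau of the embedding generated
by `(p ^ x)` in `⨁ Λ/(p ^ (x + l))`, for a list of pairs `(x, l)` with `x` increasing. -/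
def poleHeights : List (ℕ × ℕ) → ℕ → Multiset ℕ
  | [], _ => 0
  | c :: L, i => (c.1 + min i c.2) ::ₘ poleHeights L (max i c.2)

/-- The order exponent of the element `(p ^ x)` of `⨁ Λ/(p ^ (x + l))`. -/
def poleOrder (L : List (ℕ × ℕ)) : ℕ := (L.map Prod.snd).foldr max 0

@[simp] lemma poleOrder_nil : poleOrder [] = 0 := rfl

@[simp] lemma poleOrder_cons (c : ℕ × ℕ) (L : List (ℕ × ℕ)) :
    poleOrder (c :: L) = max c.2 (poleOrder L) := rfl

lemma poleHeights_of_le (L : List (ℕ × ℕ)) {i : ℕ} (h : poleOrder L ≤ i) :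
    poleHeights L i = (L.map fun c => c.1 + c.2 : Multiset ℕ) := by
  induction L generalizing i with
  | nil => rfl
  | cons c L ih =>
    rw [poleOrder_cons] at h
    rw [poleHeights, ih (by omega), min_eq_right (by omega)]
    simp

/-- The deficit `max i (poleOrder L) - i` is the length of the submodule generated by `pⁱ` times the
generator. -/
lemma sum_poleHeights (L : List (ℕ × ℕ)) (i : ℕ) :
    (poleHeights L i).sum + max i (poleOrder L) = (L.map fun c => c.1 + c.2).sum + i := by
  induction L generalizing i with
  | nil => simp [poleHeights]
  | cons c L ih =>
    have := ih (max i c.2)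
    rw [poleHeights, Multiset.sum_cons, List.map_cons, List.sum_cons, poleOrder_cons]
    omega

lemma rowCount_poleHeights_mono (L : List (ℕ × ℕ)) (r : ℕ) {i i' : ℕ} (h : i ≤ i') :
    rowCount (poleHeights L i) r ≤ rowCount (poleHeights L i') r := by
  induction L generalizing i i' with
  | nil => simp [poleHeights]
  | cons c L ih =>
    have := ih (show max i c.2 ≤ max i' c.2 by omega)
    rw [poleHeights, poleHeights, rowCount_cons, rowCount_cons]
    split_ifs <;> omega

/-- Two levels with `i' ≤ i + 1` are allowed, rather than `i + 1` and `i`, because this relation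
survives taking the maximum with `c.2` in the induction. -/
lemma rowCount_poleHeights_succ (L : List (ℕ × ℕ)) (r : ℕ) {i i' : ℕ} (h : i' ≤ i + 1) :
    rowCount (poleHeights L i') (r + 1) ≤ rowCount (poleHeights L i) r := by
  induction L generalizing i i' with
  | nil => simp [poleHeights]
  | cons c L ih =>
    have := ih (show max i' c.2 ≤ max i c.2 + 1 by omega)
    rw [poleHeights, poleHeights, rowCount_cons, rowCount_cons]
    split_ifs <;> omega

/-- Each entry occurs at most once in a pole: a column with `c.2 > i` takes the entry `i + 1` or
already lies beyond it, and freezes all later columns. -/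
lemma truncSum_poleHeights_succ_le (L : List (ℕ × ℕ)) (i r : ℕ) :
    truncSum (poleHeights L (i + 1)) r ≤ truncSum (poleHeights L i) r + 1 := by
  induction L generalizing i with
  | nil => simp [poleHeights]
  | cons c L ih =>
    rw [poleHeights, poleHeights, truncSum_cons, truncSum_cons]
    rcases le_or_gt c.2 i with h | h
    · rw [max_eq_left h, max_eq_left (by omega)]
      have := ih i
      omega
    · rw [max_eq_right h.le, max_eq_right h]
      omega

/-- The entry `i + 1`, if present in the column of `c`, sits in row `c.1 + i`, outside the first `r`
rows. -/
lemma truncSum_poleHeights_succ_eq (L : List (ℕ × ℕ)) {i r : ℕ} (hL : ∀ c ∈ L, r ≤ c.1 + i) :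
    truncSum (poleHeights L (i + 1)) r = truncSum (poleHeights L i) r := by
  induction L generalizing i with
  | nil => simp [poleHeights]
  | cons c L ih =>
    rw [poleHeights, poleHeights, truncSum_cons, truncSum_cons]
    have hc := hL c (by simp)
    rcases le_or_gt c.2 i with h | h
    · rw [max_eq_left h, max_eq_left (by omega), ih fun d hd => hL d (by simp [hd])]
      omega
    · rw [max_eq_right h.le, max_eq_right h]
      omega

/-- The only delicate case is a first column ending with `e + 1`, when `e + 2` may occur in a later
column. Since `x` increases along `L`, that box is in a strictly lower row, so it enters the first
`r + 1` rows only if the box `e + 1` is in the first `r`. -/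
lemma truncSum_poleHeights_lattice {L : List (ℕ × ℕ)} (hL : L.Pairwise fun c d => c.1 ≤ d.1)
    (e r : ℕ) :
    truncSum (poleHeights L (e + 2)) (r + 1) + truncSum (poleHeights L e) r ≤
      truncSum (poleHeights L (e + 1)) (r + 1) + truncSum (poleHeights L (e + 1)) r := by
  induction L generalizing e with
  | nil => simp [poleHeights]
  | cons c L ih =>
    rw [List.pairwise_cons] at hL
    simp only [poleHeights, truncSum_cons]
    rcases lt_trichotomy c.2 (e + 1) with h | h | h
    · rw [max_eq_left (by omega), max_eq_left (by omega), max_eq_left (by omega)]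
      have := ih hL.2 e
      omega
    · rw [max_eq_left (by omega), max_eq_right (by omega), max_eq_right (by omega), h]
      rcases le_or_gt (c.1 + e + 1) r with hr | hr
      · have : truncSum (poleHeights L (e + 2)) (r + 1) ≤ _ :=
          truncSum_poleHeights_succ_le L (e + 1) (r + 1)
        omega
      · have := truncSum_poleHeights_succ_eq L (i := e + 1) (r := r + 1)
          fun d hd => by have := hL.1 d hd; omega
        rw [this]
        omega
    · rw [max_eq_right (by omega), max_eq_right (by omega), max_eq_right (by omega)]
      omega

namespace Tableau

/-- A tableau that consists of the columns given by a list of pairs `(x, l)`. -/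
lemma exists_columns_poleHeights (L : List (ℕ × ℕ)) (m : ℕ) :
    ∃ C : List Tableau, (∀ T ∈ C, T.IsColumn) ∧ ∀ i,
      (C.map fun T => partitionParts (T.part i)).sum =
        (poleHeights L (max i m)).filter (0 < ·) := by
  induction L generalizing m with
  | nil => exact ⟨[], by simp, by simp [poleHeights]⟩
  | cons c L ih =>
    obtain ⟨C, hC, hsum⟩ := ih (max m c.2)
    obtain ⟨T, hT, hpart⟩ : ∃ T : Tableau, T.IsColumn ∧
        ∀ i, T.part i = singlePart (c.1 + min (max i m) c.2) := by
      -- Here `m` is the largest entry used by earlier columns: this column carries `m + 1, …, c.2`,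
      -- or nothing if `c.2 ≤ m`.
      rcases le_or_gt c.2 m with h | h
      · refine ⟨column 1 0 (c.1 + c.2), Or.inl ⟨_, rfl⟩, fun i => ?_⟩
        simp only [column]
        congr 1
        omega
      · refine ⟨column (m + 1) c.2 (c.1 + c.2),
          Or.inr ⟨_, _, _, by omega, by omega, by omega, rfl⟩, fun i => ?_⟩
        simp only [column]
        congr 1
        omega
    refine ⟨T :: C, by simpa using ⟨hT, hC⟩, fun i => ?_⟩
    rw [List.map_cons, List.sum_cons, hsum, hpart, partitionParts_singlePart, poleHeights,
      ← Multiset.singleton_add, Multiset.filter_add, max_assoc]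

lemma isUnionOfColumns_of_list {Γ : Tableau} (C : List Tableau) (hC : ∀ T ∈ C, T.IsColumn)
    (h : ∀ i, partitionParts (Γ.part i) = (C.map fun T => partitionParts (T.part i)).sum) :
    Γ.IsUnionOfColumns := by
  refine ⟨C.length, C.get, fun k => hC _ (List.get_mem _ _), fun i => ?_⟩
  rw [h i]
  conv_lhs => rw [← List.ofFn_get C]
  rw [List.map_ofFn, List.sum_ofFn]
  rfl

/-- The tableau of a direct sum of cyclic embeddings, each given by a list of pairs `(x, l)`. -/
def ofPoles {m : ℕ} (L : Fin m → List (ℕ × ℕ)) : Tableau where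
  part i := ofParts (∑ k, poleHeights (L k) i)
  mono i i' h := YoungDiagram.le_iff_rowLen.2 fun r => by
    rw [rowLen_ofParts, rowLen_ofParts, rowCount_sum, rowCount_sum]
    exact Finset.sum_le_sum fun k _ => rowCount_poleHeights_mono _ _ h
  stable := ⟨∑ k, poleOrder (L k), fun i hi => by
    congr 1
    refine Finset.sum_congr rfl fun k _ => ?_
    have hk := Finset.single_le_sum (fun k _ => Nat.zero_le (poleOrder (L k))) (Finset.mem_univ k)
    rw [poleHeights_of_le _ hk, poleHeights_of_le _ (hk.trans hi)]⟩

variable {m : ℕ} (L : Fin m → List (ℕ × ℕ))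

lemma partitionParts_ofPoles (i : ℕ) :
    partitionParts ((ofPoles L).part i) = (∑ k, poleHeights (L k) i).filter (0 < ·) :=
  partitionParts_ofParts _

lemma truncSum_ofPoles (i r : ℕ) :
    truncSum (partitionParts ((ofPoles L).part i)) r = ∑ k, truncSum (poleHeights (L k) i) r := by
  rw [← truncSum_sum, truncSum_eq_sum_rowCount, truncSum_eq_sum_rowCount]
  exact Finset.sum_congr rfl fun j _ => by rw [rowCount_partitionParts, ofPoles, rowLen_ofParts]

lemma isLR_ofPoles (hL : ∀ k, (L k).Pairwise fun c d => c.1 ≤ d.1) : (ofPoles L).IsLR := by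
  refine isLR_of_rows (fun e r => ?_) (fun e r he => ?_)
  · simp only [ofPoles, rowLen_ofParts, rowCount_sum]
    exact Finset.sum_le_sum fun k _ => rowCount_poleHeights_succ _ _ le_rfl
  · obtain ⟨e, rfl⟩ : ∃ d, e = d + 1 := ⟨e - 1, by omega⟩
    simp only [truncSum_ofPoles, ← Finset.sum_add_distrib, Nat.add_sub_cancel]
    exact Finset.sum_le_sum fun k _ => truncSum_poleHeights_lattice (hL k) e r

lemma isUnionOfColumns_ofPoles : (ofPoles L).IsUnionOfColumns := by
  choose C hC hsum using fun k => exists_columns_poleHeights (L k) 0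
  refine isUnionOfColumns_of_list (List.ofFn C).flatten ?_ fun i => ?_
  · intro T hT
    obtain ⟨l, hl, hT⟩ := List.mem_flatten.1 hT
    obtain ⟨k, rfl⟩ := (List.mem_ofFn' _ _).1 hl
    exact hC k T hT
  · rw [List.map_flatten, List.sum_flatten, List.map_map, List.map_ofFn, List.sum_ofFn]
    rw [ofPoles, partitionParts_ofParts]
    simp only [Function.comp_def, hsum, Nat.max_zero]
    exact multiset_filter_sum _ _ _

lemma hasShape_ofPoles {β γ : YoungDiagram}
    (hβ : ∀ i, β.rowLen i = rowCount (∑ k, ((L k).map fun c => c.1 + c.2 : Multiset ℕ)) i)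
    (hγ : ∀ i, γ.rowLen i = rowCount (∑ k, poleHeights (L k) 0) i) :
    (ofPoles L).HasShape β γ := by
  refine ⟨YoungDiagram.ext_rowLen fun i => by rw [hγ, ofPoles, rowLen_ofParts],
    ∑ k, poleOrder (L k), fun i hi => YoungDiagram.ext_rowLen fun r => ?_⟩
  rw [hβ, ofPoles, rowLen_ofParts]
  congr 1
  refine Finset.sum_congr rfl fun k _ => ?_
  exact poleHeights_of_le _
    ((Finset.single_le_sum (fun k _ => Nat.zero_le (poleOrder (L k))) (Finset.mem_univ k)).trans hi)

end Tableau

/-! ### The content of a union of poles -/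

lemma card_cells_eq_sum (μ : YoungDiagram) : μ.cells.card = (partitionParts μ).sum := by
  have h1 : μ.cells = μ.cells.filter (·.1 < μ.colLen 0) := by
    refine (Finset.filter_true_of_mem ?_).symm
    rintro ⟨i, j⟩ hc
    rw [YoungDiagram.mem_cells, YoungDiagram.mem_iff_lt_colLen] at hc
    exact hc.trans_le (μ.colLen_anti 0 j (Nat.zero_le j))
  rw [h1, card_filter_fst_lt, truncSum]
  congr 1
  conv_rhs => rw [← Multiset.map_id (partitionParts μ)]
  refine Multiset.map_congr rfl fun h hh => min_eq_left ?_
  obtain ⟨j, -, rfl⟩ := Multiset.mem_map.1 hh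
  exact μ.colLen_anti 0 j (Nat.zero_le j)

lemma sum_filter_pos (s : Multiset ℕ) : (s.filter (0 < ·)).sum = s.sum := by
  induction s using Multiset.induction_on with
  | empty => rfl
  | cons h s ih =>
    rcases Nat.eq_zero_or_pos h with rfl | h0
    · simp [ih]
    · rw [Multiset.filter_cons_of_pos (p := (0 < ·)) _ h0, Multiset.sum_cons, Multiset.sum_cons, ih]

namespace Tableau

lemma card_boxes_add (Γ : Tableau) (e : ℕ) :
    (Γ.boxes e).card + (partitionParts (Γ.part (e - 1))).sum = (partitionParts (Γ.part e)).sum := by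
  rw [← card_cells_eq_sum, ← card_cells_eq_sum, boxes]
  exact Finset.card_sdiff_add_card_eq_card
    (YoungDiagram.cells_subset_iff.2 (Γ.mono (Nat.sub_le e 1)))

/-- A pole of order `n` contributes each of the entries `1, …, n` exactly once. -/
lemma card_boxes_of_poles {Γ : Tableau} {m : ℕ} (L : Fin m → List (ℕ × ℕ))
    (hΓ : ∀ i, partitionParts (Γ.part i) = (∑ k, poleHeights (L k) i).filter (0 < ·)) (e : ℕ) :
    (Γ.boxes (e + 1)).card = rowCount (∑ k, {poleOrder (L k)}) e := by
  have h := Γ.card_boxes_add (e + 1)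
  rw [Nat.add_sub_cancel, hΓ, hΓ, sum_filter_pos, sum_filter_pos, Multiset.sum_sum,
    Multiset.sum_sum] at h
  have key : ∀ k, (poleHeights (L k) (e + 1)).sum =
      (poleHeights (L k) e).sum + rowCount {poleOrder (L k)} e := by
    intro k
    have h1 := sum_poleHeights (L k) (e + 1)
    have h2 := sum_poleHeights (L k) e
    rw [← Multiset.cons_zero, rowCount_cons, rowCount_zero]
    split_ifs <;> omega
  rw [Finset.sum_congr rfl fun k _ => key k, Finset.sum_add_distrib, ← rowCount_sum] at h
  omega

lemma hasContent_of_poles {Γ : Tableau} {m : ℕ} (L : Fin m → List (ℕ × ℕ))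
    (hΓ : ∀ i, partitionParts (Γ.part i) = (∑ k, poleHeights (L k) i).filter (0 < ·))
    {α : YoungDiagram} :
    Γ.HasContent α ↔ ∀ i, α.rowLen i = rowCount (∑ k, {poleOrder (L k)}) i := by
  constructor
  · intro h i
    rw [← card_boxes_of_poles L hΓ, h (i + 1) (by omega), Nat.add_sub_cancel]
  · intro h e he
    obtain ⟨e, rfl⟩ : ∃ d, e = d + 1 := ⟨e - 1, by omega⟩
    rw [card_boxes_of_poles L hΓ, Nat.add_sub_cancel, h]

end Tableau

/-! ### Chaining columns into poles -/

lemma poleHeights_append (L : List (ℕ × ℕ)) (c : ℕ × ℕ) (i : ℕ) :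
    poleHeights (L ++ [c]) i =
      poleHeights L i + {c.1 + min (max i (poleOrder L)) c.2} := by
  induction L generalizing i with
  | nil => simp [poleHeights]
  | cons d L ih =>
    rw [List.cons_append, poleHeights, poleHeights, ih, Multiset.cons_add, poleOrder_cons,
      max_assoc]

lemma poleOrder_append (L : List (ℕ × ℕ)) (c : ℕ × ℕ) :
    poleOrder (L ++ [c]) = max (poleOrder L) c.2 := by
  induction L with
  | nil => simp
  | cons d L ih => rw [List.cons_append, poleOrder_cons, ih, poleOrder_cons, max_assoc]

/-- The condition on a multiset of columns `C(e, l)` of height `x + l`, given as triples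
`(e, x, l)`, that allows to arrange them as tableaux of cyclic embeddings. -/
def ColumnsMatch (T : Multiset (ℕ × ℕ × ℕ)) : Prop :=
  ∀ e y, 1 ≤ e → T.countP (fun c => c.1 = e + 1 ∧ c.2.1 ≤ y) ≤
    T.countP (fun c => c.2.2 = e ∧ c.2.1 ≤ y)

/-- The height at level `i` of the column given by a triple `(e, x, l)`. -/
def columnHeight (i : ℕ) (c : ℕ × ℕ × ℕ) : ℕ := c.2.1 + max (c.1 - 1) (min i c.2.2)

lemma Multiset.exists_lex_max {T : Multiset (ℕ × ℕ × ℕ)} (hT : T ≠ 0) :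
    ∃ c ∈ T, ∀ d ∈ T, d.1 < c.1 ∨ d.1 = c.1 ∧ d.2.1 ≤ c.2.1 := by
  obtain ⟨a, ha⟩ := Multiset.exists_mem_of_ne_zero hT
  obtain ⟨c, hc, hmax⟩ := T.toFinset.exists_max_image (fun c => toLex (c.1, c.2.1))
    ⟨a, Multiset.mem_toFinset.2 ha⟩
  refine ⟨c, Multiset.mem_toFinset.1 hc, fun d hd => ?_⟩
  simpa [Prod.Lex.toLex_le_toLex] using hmax d (Multiset.mem_toFinset.2 hd)

/-- Greedy matching: columns are added in lexicographic order of `(e, x)`, each one with `e > 1`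
being appended to a pole of order `e - 1` whose last `x` is no larger. The final clause is the
invariant that makes this possible: a pole end can only have been used up by a column starting with
the next entry. -/
lemma exists_poles_of_columnsMatch (T : Multiset (ℕ × ℕ × ℕ))
    (hT : ∀ c ∈ T, 1 ≤ c.1 ∧ (c.1 ≤ c.2.2 ∨ c.1 = 1 ∧ c.2.2 = 0)) (hmatch : ColumnsMatch T) :
    ∃ S : Multiset (List (ℕ × ℕ) × ℕ × ℕ),
      (∀ t ∈ S, t.1.Pairwise (fun c d => c.1 ≤ d.1) ∧ (∀ c ∈ t.1, c.1 ≤ t.2.1) ∧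
        poleOrder t.1 = t.2.2) ∧
      (∀ i, (S.map fun t => poleHeights t.1 i).sum = T.map (columnHeight i)) ∧
      ∀ e y, 1 ≤ e → T.countP (fun c => c.2.2 = e ∧ c.2.1 ≤ y) ≤
        T.countP (fun c => c.1 = e + 1) + S.countP (fun t => t.2.2 = e ∧ t.2.1 ≤ y) := by
  induction hn : T.card generalizing T with
  | zero =>
    rw [Multiset.card_eq_zero] at hn
    subst hn
    exact ⟨0, by simp, by simp, by simp⟩
  | succ n ih =>
    obtain ⟨⟨e, x, l⟩, hc, hmax⟩ := Multiset.exists_lex_max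
      (T := T) (by rintro rfl; simp at hn)
    obtain ⟨T, rfl⟩ := Multiset.exists_cons_of_mem hc
    dsimp only at hmax
    have hc0 := hT _ hc
    dsimp only at hc0
    have hmatch' : ColumnsMatch T := by
      intro e' y he'
      have h := hmatch e' y he'
      rw [Multiset.countP_cons, Multiset.countP_cons] at h
      by_cases hl : l = e'
      -- Removing a column ending with `l` affects only the condition for `l`, and no column starts
      -- with `l + 1` because the first entry `e ≤ l` is maximal.
      · rw [Multiset.countP_eq_zero.2]
        · exact Nat.zero_le _
        · rintro d hd ⟨h1, -⟩
          have := hmax d (Multiset.mem_cons_of_mem hd)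
          omega
      · dsimp only at h
        split_ifs at h <;> omega
    obtain ⟨S, hS, hsum, hcount⟩ := ih T (fun d hd => hT d (Multiset.mem_cons_of_mem hd)) hmatch'
      (by simpa using hn)
    rcases eq_or_lt_of_le hc0.1 with he | he
    · subst he
      refine ⟨([(x, l)], x, l) ::ₘ S, ?_, fun i => ?_, fun e' y he' => ?_⟩
      · intro t ht
        rcases Multiset.mem_cons.1 ht with rfl | ht
        · simp
        · exact hS t ht
      · rw [Multiset.map_cons, Multiset.sum_cons, hsum, Multiset.map_cons]
        simp [poleHeights, columnHeight]
      · have := hcount e' y he'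
        simp only [Multiset.countP_cons]
        split_ifs <;> omega
    · obtain ⟨e, rfl⟩ : ∃ d, e = d + 1 := ⟨e - 1, by omega⟩
      -- By maximality of `x`, all other columns starting with `e + 1` satisfy the bound `x`, so
      -- their number cancels between matching condition and invariant, leaving a free pole for the
      -- new column.
      have hex : 0 < S.countP (fun t => t.2.2 = e ∧ t.2.1 ≤ x) := by
        have h1 := hmatch e x (by omega)
        have h2 := hcount e x (by omega)
        rw [Multiset.countP_cons, Multiset.countP_cons, if_pos ⟨rfl, le_rfl⟩,
          if_neg (by dsimp only; omega)] at h1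
        have h3 : T.countP (fun c => c.1 = e + 1 ∧ c.2.1 ≤ x) = T.countP (fun c => c.1 = e + 1) :=
          Multiset.countP_congr rfl fun d hd => by
            have := hmax d (Multiset.mem_cons_of_mem hd)
            simp only [eq_iff_iff]
            omega
        omega
      obtain ⟨⟨L, X, M⟩, ht, hM, hX⟩ := Multiset.countP_pos.1 hex
      obtain ⟨S, rfl⟩ := Multiset.exists_cons_of_mem ht
      dsimp only at hM hX
      subst hM
      obtain ⟨hL1, hL2, hL3⟩ := hS _ ht
      dsimp only at hL1 hL2 hL3
      refine ⟨(L ++ [(x, l)], x, l) ::ₘ S, ?_, fun i => ?_, fun e' y he' => ?_⟩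
      · intro t ht
        rcases Multiset.mem_cons.1 ht with rfl | ht
        · dsimp only
          refine ⟨?_, ?_, ?_⟩
          · refine List.pairwise_append.2 ⟨hL1, by simp, fun c hc d hd => ?_⟩
            rw [List.mem_singleton.1 hd]
            exact (hL2 c hc).trans hX
          · intro c hc
            rcases List.mem_append.1 hc with hc | hc
            · exact (hL2 c hc).trans hX
            · rw [List.mem_singleton.1 hc]
          · rw [poleOrder_append, hL3]
            exact max_eq_right (by dsimp only; omega)
        · exact hS t (Multiset.mem_cons_of_mem ht)
      · have h := hsum i
        rw [Multiset.map_cons, Multiset.sum_cons] at h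
        rw [Multiset.map_cons, Multiset.sum_cons, poleHeights_append, Multiset.map_cons, ← h, hL3,
          ← Multiset.singleton_add, columnHeight]
        dsimp only
        rw [show min (max i M) l = max (M + 1 - 1) (min i l) by omega]
        abel
      · have h := hcount e' y he'
        simp only [Multiset.countP_cons] at h ⊢
        split_ifs at h ⊢ <;> omega

namespace Tableau

lemma IsColumn.exists_triple {C : Tableau} (hC : C.IsColumn) :
    ∃ e f n, 1 ≤ e ∧ (e ≤ f ∨ e = 1 ∧ f = 0) ∧ f + 1 ≤ n + e ∧
      ∀ i, C.part i = singlePart (n - (f - max (e - 1) (min i f))) := by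
  rcases hC with ⟨n, rfl⟩ | ⟨e, f, n, h1, h2, h3, rfl⟩
  · exact ⟨1, 0, n, le_rfl, Or.inr ⟨rfl, rfl⟩, by omega, fun _ => rfl⟩
  · exact ⟨e, f, n, h1, Or.inl h2, h3, fun _ => rfl⟩

lemma truncSum_filter_pos (s : Multiset ℕ) (r : ℕ) :
    truncSum (s.filter (0 < ·)) r = truncSum s r := by
  rw [truncSum_eq_sum_rowCount, truncSum_eq_sum_rowCount]
  exact Finset.sum_congr rfl fun i _ => rowCount_filter_pos s i

/-- In a column containing both `e` and `e + 1`, the second lies one row below the first, so their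
contributions cancel. What remains is a first entry `e + 1` or a last entry `e`. -/
lemma column_truncSum_identity {E F N e : ℕ} (h1 : 1 ≤ E) (h2 : E ≤ F ∨ E = 1 ∧ F = 0)
    (h3 : F + 1 ≤ N + E) (he : 1 ≤ e) (r : ℕ) :
    ((min (N - (F - max (E - 1) (min (e + 1) F))) (r + 1) +
        min (N - (F - max (E - 1) (min (e - 1) F))) r) + if F = e ∧ N ≤ r then 1 else 0) =
      (min (N - (F - max (E - 1) (min e F))) (r + 1) +
        min (N - (F - max (E - 1) (min e F))) r) +
        if E = e + 1 ∧ N + e ≤ r + F then 1 else 0 := by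
  generalize ha : N - (F - max (E - 1) (min (e + 1) F)) = a
  generalize hb : N - (F - max (E - 1) (min e F)) = b
  generalize hc : N - (F - max (E - 1) (min (e - 1) F)) = c
  rcases lt_trichotomy E (e + 1) with h | h | h
  · rw [if_neg (show ¬(E = e + 1 ∧ _) by omega)]
    rcases lt_trichotomy F e with hF | hF | hF
    · rw [if_neg (by omega), show a = b by omega, show c = b by omega]
    · have : c + 1 = b := by omega
      rw [show a = b by omega]
      have : b = N := by omega
      split_ifs <;> omega
    · rw [if_neg (by omega), show a = b + 1 by omega, show b = c + 1 by omega]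
      omega
  · have : b + F = N + e := by omega
    rw [if_neg (show ¬(F = e ∧ _) by omega), show a = b + 1 by omega, show c = b by omega]
    split_ifs <;> omega
  · rw [if_neg (show ¬(F = e ∧ _) by omega), if_neg (by omega), show a = b by omega,
      show c = b by omega]

/-- An LR-tableau that is a union of columns can be arranged as the tableau of a direct sum
of cyclic embeddings. -/
lemma IsLR.exists_poles {Γ : Tableau} (hΓ : Γ.IsLR) (hcol : Γ.IsUnionOfColumns) :
    ∃ (m : ℕ) (L : Fin m → List (ℕ × ℕ)), (∀ k, (L k).Pairwise fun c d => c.1 ≤ d.1) ∧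
      ∀ i, partitionParts (Γ.part i) = (∑ k, poleHeights (L k) i).filter (0 < ·) := by
  obtain ⟨m, C, hC, hunion⟩ := hcol
  choose E F N hE hEF hFN hpart using fun k => (hC k).exists_triple
  have hcount : ∀ e r, 1 ≤ e →
      (∑ k, if E k = e + 1 ∧ N k + e ≤ r + F k then 1 else 0) ≤
        ∑ k, if F k = e ∧ N k ≤ r then 1 else 0 := by
    intro e r he
    have h := hΓ.truncSum_le he r
    simp only [hunion _, truncSum_sum, hpart, partitionParts_singlePart, truncSum_filter_pos,
      ← Multiset.cons_zero, truncSum_cons, truncSum_zero, add_zero] at h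
    have key := fun k => column_truncSum_identity (hE k) (hEF k) (hFN k) he r
    have h' := Finset.sum_congr (rfl : (Finset.univ : Finset (Fin m)) = _) fun k _ => key k
    simp only [Finset.sum_add_distrib] at h'
    omega
  -- The definition of a column allows entries larger than their row position; the lattice condition
  -- excludes this. A column with `N < F` starts with some `E > 1`, and `hcount` yields another such
  -- column ending with `E - 1`, hence with a smaller first entry.
  have hNF : ∀ e k, E k = e → F k ≤ N k := by
    intro e
    induction e using Nat.strong_induction_on with
    | _ e ih =>
      intro k hk
      by_contra! hlt
      have h1 := hE k
      have h2 := hEF k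
      have h3 := hFN k
      have h4 := hcount (e - 1) (e - 1 - 1) (by omega)
      have h5 : 0 < ∑ k, if F k = e - 1 ∧ N k ≤ e - 1 - 1 then 1 else 0 := by
        refine lt_of_lt_of_le ?_ h4
        refine Finset.sum_pos' (fun _ _ => Nat.zero_le _) ⟨k, Finset.mem_univ k, ?_⟩
        rw [if_pos (by omega)]
        exact one_pos
      obtain ⟨k', -, hk'⟩ := Finset.exists_ne_zero_of_sum_ne_zero h5.ne'
      rw [ne_eq, ite_eq_right_iff, Classical.not_imp] at hk'
      have h6 := hEF k'
      have := ih (E k') (by omega) k' rfl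
      omega
  obtain ⟨S, hS, hsum, -⟩ := exists_poles_of_columnsMatch
    (Finset.univ.val.map fun k => (E k, N k - F k, F k)) (by
      intro c hc
      obtain ⟨k, -, rfl⟩ := Multiset.mem_map.1 hc
      exact ⟨hE k, hEF k⟩) (by
      intro e y he
      -- With `x = N - F`, both row bounds at `r = y + e` become `x ≤ y`.
      have h := hcount e (y + e) he
      rw [Finset.sum_boole, Finset.sum_boole, Nat.cast_id, Nat.cast_id, Finset.card_def, Finset.card_def,
        Finset.filter_val, Finset.filter_val] at h
      rw [Multiset.countP_map, Multiset.countP_map]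
      refine le_trans (le_of_eq ?_) (h.trans (le_of_eq ?_))
      · refine congrArg Multiset.card (Multiset.filter_congr fun k _ => ?_)
        have := hNF _ k rfl
        dsimp only
        omega
      · refine congrArg Multiset.card (Multiset.filter_congr fun k _ => ?_)
        have := hNF _ k rfl
        dsimp only
        omega)
  refine ⟨S.toList.length, fun k => (S.toList.get k).1,
    fun k => (hS _ (Multiset.mem_toList.1 (List.get_mem _ _))).1, fun i => ?_⟩
  have h1 : ∑ k, poleHeights (S.toList.get k).1 i = (S.map fun t => poleHeights t.1 i).sum := by
    conv_rhs => rw [← Multiset.coe_toList S, ← List.ofFn_get S.toList]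
    rw [Multiset.map_coe, Multiset.sum_coe, List.map_ofFn, List.sum_ofFn]
    rfl
  rw [h1, hsum, partitionParts_eq_iff]
  intro r
  rw [← rowCount_partitionParts, hunion i, rowCount_sum, Multiset.map_map]
  rw [show Multiset.map (columnHeight i ∘ fun k => (E k, N k - F k, F k)) Finset.univ.val =
    ∑ k, {columnHeight i (E k, N k - F k, F k)} by
      rw [← Multiset.sum_map_singleton (Multiset.map _ _), Multiset.map_map]; rfl,
    rowCount_sum]
  refine Finset.sum_congr rfl fun k _ => ?_
  rw [hpart, partitionParts_singlePart, rowCount_filter_pos, columnHeight]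
  congr 2
  have h1 := hE k
  have h2 := hEF k
  have h3 := hNF _ k rfl
  dsimp only
  omega

end Tableau

/-! ### Types of finite direct sums of cyclic modules -/

section HasType

variable {Λ : Type u} [CommRing Λ] (p : Λ)

/-- The module `M` is a finite direct sum of the modules `Λ/(p ^ h)` for `h ∈ s`. -/
def HasType (M : Type u) [AddCommGroup M] [Module Λ M] (s : Multiset ℕ) : Prop :=
  ∃ (ι : Type) (_ : Fintype ι) (h : ι → ℕ), s = ∑ k, {h k} ∧
    Nonempty (M ≃ₗ[Λ] ((k : ι) → Λ ⧸ Ideal.span {p ^ h k}))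

variable {p} {M N : Type u} [AddCommGroup M] [Module Λ M] [AddCommGroup N] [Module Λ N]
  {s t : Multiset ℕ}

lemma HasType.of_equiv (h : HasType p M s) (e : N ≃ₗ[Λ] M) : HasType p N s := by
  obtain ⟨ι, _, g, hs, ⟨f⟩⟩ := h
  exact ⟨ι, _, g, hs, ⟨e.trans f⟩⟩

lemma HasType.pi {κ : Type} [Fintype κ] {M : κ → Type u} [∀ k, AddCommGroup (M k)]
    [∀ k, Module Λ (M k)] {s : κ → Multiset ℕ} (h : ∀ k, HasType p (M k) (s k)) :
    HasType p ((k : κ) → M k) (∑ k, s k) := by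
  choose ι _ g hs e using h
  refine ⟨Σ k, ι k, inferInstance, fun k => g k.1 k.2, ?_,
    ⟨(LinearEquiv.piCongrRight fun k => (e k).some).trans
      (LinearEquiv.piCurry Λ fun k j => Λ ⧸ Ideal.span {p ^ g k j}).symm⟩⟩
  rw [Fintype.sum_sigma]
  exact Finset.sum_congr rfl fun k _ => hs k

lemma HasType.prod (hM : HasType p M s) (hN : HasType p N t) : HasType p (M × N) (s + t) := by
  obtain ⟨ι, _, g, hs, ⟨e⟩⟩ := hM
  obtain ⟨κ, _, h, ht, ⟨f⟩⟩ := hN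
  refine ⟨ι ⊕ κ, inferInstance, Sum.elim g h, by simp [hs, ht], ⟨(e.prodCongr f).trans
    (LinearEquiv.sumPiEquivProdPi Λ ι κ fun k => Λ ⧸ Ideal.span {p ^ Sum.elim g h k}).symm⟩⟩

variable (p) in
lemma hasType_pi_quotient {ι : Type} [Fintype ι] (h : ι → ℕ) :
    HasType p ((k : ι) → Λ ⧸ Ideal.span {p ^ h k}) (∑ k, {h k}) :=
  ⟨ι, inferInstance, h, rfl, ⟨LinearEquiv.refl _ _⟩⟩

variable (p) in
lemma hasType_quotient (n : ℕ) : HasType p (Λ ⧸ Ideal.span {p ^ n}) {n} :=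
  ⟨Unit, inferInstance, fun _ => n, by simp, ⟨(LinearEquiv.funUnique Unit Λ _).symm⟩⟩

lemma hasType_of_subsingleton [Subsingleton M] : HasType p M 0 :=
  ⟨Empty, inferInstance, Empty.elim, by simp, ⟨0⟩⟩

lemma hasType_NMod (α : YoungDiagram) : HasType p (NMod p α) (partitionParts α) := by
  convert hasType_pi_quotient p (fun j : Fin (α.rowLen 0) => α.colLen j)
  rw [Fin.sum_univ_eq_sum_range (fun j => ({α.colLen j} : Multiset ℕ)) (α.rowLen 0), partitionParts,
    ← Multiset.sum_map_singleton (Multiset.map _ _), Multiset.map_map]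
  rfl

/-- A summand `Λ/(p ^ 0)` vanishes. Poles may produce such summands, whereas partitions have only
positive parts. -/
lemma HasType.filter_pos (h : HasType p M s) : HasType p M (s.filter (0 < ·)) := by
  obtain ⟨ι, _, g, hs, ⟨e⟩⟩ := h
  have hsub : ∀ k, ¬ 0 < g k → Subsingleton (Λ ⧸ Ideal.span {p ^ g k}) := by
    intro k hk
    rw [Ideal.Quotient.subsingleton_iff, Nat.eq_zero_of_not_pos hk, pow_zero, Ideal.span_singleton_one]
  have hbij : Function.Bijective (LinearMap.pi fun k : {k // 0 < g k} =>
      (LinearMap.proj k.1 : ((k : ι) → Λ ⧸ Ideal.span {p ^ g k}) →ₗ[Λ] _)) := by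
    constructor
    · intro a b hab
      ext k
      by_cases hk : 0 < g k
      · exact congrFun hab ⟨k, hk⟩
      · exact (hsub k hk).elim _ _
    · intro a
      refine ⟨fun k => if hk : 0 < g k then a ⟨k, hk⟩ else 0, ?_⟩
      ext k
      simp [k.2]
  refine ⟨{k // 0 < g k}, inferInstance, fun k => g k, ?_,
    ⟨e.trans (LinearEquiv.ofBijective _ hbij)⟩⟩
  rw [hs, multiset_filter_sum, ← Finset.sum_subtype (Finset.univ.filter fun k => 0 < g k) (by simp)
    (fun k => ({g k} : Multiset ℕ)), Finset.sum_filter]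
  exact Finset.sum_congr rfl fun k _ => Multiset.filter_singleton _

lemma HasType.nonempty_equiv (hM : HasType p M s) (hN : HasType p N s) :
    Nonempty (M ≃ₗ[Λ] N) := by
  obtain ⟨ι, _, g, hs, ⟨e⟩⟩ := hM
  obtain ⟨κ, _, h, ht, ⟨f⟩⟩ := hN
  have hcard : ∀ n, Fintype.card {k // g k = n} = Fintype.card {k // h k = n} := by
    intro n
    have := congrArg (Multiset.count n) (hs.symm.trans ht)
    simp only [Multiset.count_sum', Multiset.count_singleton] at this
    rw [Fintype.card_subtype, Fintype.card_subtype, Finset.card_filter, Finset.card_filter]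
    simpa only [eq_comm] using this
  let ρ : ι ≃ κ := Equiv.ofFiberEquiv (f := g) (g := h) fun n => Fintype.equivOfCardEq (hcard n)
  have hρ : ∀ k, g k = h (ρ k) := fun k => (Equiv.ofFiberEquiv_map _ k).symm
  refine ⟨(e.trans (LinearEquiv.piCongrRight fun k => Submodule.quotEquivOfEq _ _ (by rw [hρ]))).trans
    ((LinearEquiv.piCongrLeft Λ (fun k => Λ ⧸ Ideal.span {p ^ h k}) ρ).trans f.symm)⟩

lemma HasType.nonempty_equiv_NMod (hM : HasType p M s) {α : YoungDiagram}
    (hα : ∀ i, α.rowLen i = rowCount s i) : Nonempty (M ≃ₗ[Λ] NMod p α) := by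
  have h := hM.filter_pos
  rw [← partitionParts_eq_iff.2 hα] at h
  exact h.nonempty_equiv (hasType_NMod α)

lemma Submodule.nonempty_quotient_equiv {R M N : Type*} [Ring R] [AddCommGroup M] [Module R M]
    [AddCommGroup N] [Module R N] (φ : M →ₗ[R] N) (hφ : Function.Surjective φ)
    {S : Submodule R M} (hS : ∀ m, φ m = 0 ↔ m ∈ S) : Nonempty ((M ⧸ S) ≃ₗ[R] N) :=
  ⟨(Submodule.quotEquivOfEq _ _ (by ext; rw [LinearMap.mem_ker, hS])).trans
    (φ.quotKerEquivOfSurjective hφ)⟩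

lemma mk_eq_zero_iff_dvd (a t : Λ) :
    (Submodule.Quotient.mk t : Λ ⧸ Ideal.span {a}) = 0 ↔ a ∣ t := by
  rw [Submodule.Quotient.mk_eq_zero, Ideal.mem_span_singleton]

/-- The canonical map `Λ/(p ^ n) → Λ/(p ^ m)` for `m ≤ n`. -/
def quotientPowMap (p : Λ) {m n : ℕ} (h : m ≤ n) :
    (Λ ⧸ Ideal.span {p ^ n}) →ₗ[Λ] (Λ ⧸ Ideal.span {p ^ m}) :=
  Submodule.factor (Ideal.span_singleton_le_span_singleton.2 (pow_dvd_pow p h))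

@[simp] lemma quotientPowMap_mk {m n : ℕ} (h : m ≤ n) (t : Λ) :
    quotientPowMap p h (Submodule.Quotient.mk t) = Submodule.Quotient.mk t := rfl

lemma quotientPowMap_surjective {m n : ℕ} (h : m ≤ n) :
    Function.Surjective (quotientPowMap p h) := by
  intro a
  obtain ⟨t, rfl⟩ := Submodule.Quotient.mk_surjective _ a
  exact ⟨Submodule.Quotient.mk t, rfl⟩

lemma HasType.quotient_pow (hM : HasType p M s) (r : ℕ) :
    HasType p (M ⧸ LinearMap.range (p ^ r • (LinearMap.id : M →ₗ[Λ] M))) (s.map (min · r)) := by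
  obtain ⟨ι, _, g, rfl, ⟨e⟩⟩ := hM
  let φ : M →ₗ[Λ] ((k : ι) → Λ ⧸ Ideal.span {p ^ min (g k) r}) :=
    LinearMap.piMap (fun k => quotientPowMap p (min_le_left (g k) r)) ∘ₗ e.toLinearMap
  have hφ : Function.Surjective φ :=
    (Function.Surjective.piMap fun k =>
      quotientPowMap_surjective (p := p) (min_le_left (g k) r)).comp e.surjective
  obtain ⟨f⟩ := Submodule.nonempty_quotient_equiv φ hφ
    (S := LinearMap.range (p ^ r • (LinearMap.id : M →ₗ[Λ] M))) (by
      intro m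
      constructor
      · intro hm
        have : ∀ k, ∃ a, p ^ r • a = e m k := by
          intro k
          have hk : quotientPowMap p (min_le_left (g k) r) (e m k) = 0 := congrFun hm k
          obtain ⟨t, ht⟩ := Submodule.Quotient.mk_surjective _ (e m k)
          rw [← ht] at hk ⊢
          rw [quotientPowMap_mk, mk_eq_zero_iff_dvd] at hk
          rcases le_total (g k) r with h | h
          · rw [min_eq_left h] at hk
            exact ⟨0, by rw [smul_zero, (mk_eq_zero_iff_dvd _ _).2 hk]⟩
          · rw [min_eq_right h] at hk
            obtain ⟨w, rfl⟩ := hk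
            exact ⟨Submodule.Quotient.mk w, rfl⟩
        choose a ha using this
        refine ⟨e.symm a, e.injective ?_⟩
        rw [LinearMap.smul_apply, LinearMap.id_apply, map_smul, e.apply_symm_apply]
        exact funext ha
      · rintro ⟨a, rfl⟩
        ext k
        obtain ⟨t, ht⟩ := Submodule.Quotient.mk_surjective _ (e a k)
        have : φ ((p ^ r • LinearMap.id : M →ₗ[Λ] M) a) k =
            p ^ r • quotientPowMap p (min_le_left (g k) r) (e a k) := by
          rw [LinearMap.smul_apply, LinearMap.id_apply, map_smul]
          rfl
        rw [this, ← ht, quotientPowMap_mk, ← Submodule.Quotient.mk_smul, Pi.zero_apply,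
          mk_eq_zero_iff_dvd]
        exact (pow_dvd_pow p (min_le_right _ _)).mul_right t)
  convert (hasType_pi_quotient p fun k => min (g k) r).of_equiv f
  exact map_sum (Multiset.mapAddMonoidHom (min · r)) _ _

lemma HasType.length_eq [IsDomain Λ] [IsDiscreteValuationRing Λ] (hp : Irreducible p)
    (hM : HasType p M s) : Module.length Λ M = s.sum := by
  obtain ⟨ι, _, g, rfl, ⟨e⟩⟩ := hM
  rw [e.length_eq, Module.length_pi_of_fintype, Multiset.sum_sum, Nat.cast_sum]
  refine Finset.sum_congr rfl fun k _ => ?_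
  rw [← Ideal.span_singleton_pow, ← hp.maximalIdeal_eq,
    IsDiscreteValuationRing.length_quotient_pow_maximalIdeal, Multiset.sum_singleton]

/-- The type of a module is unique. -/
lemma HasType.rowCount_eq [IsDomain Λ] [IsDiscreteValuationRing Λ] (hp : Irreducible p)
    (hs : HasType p M s) (ht : HasType p M t) (i : ℕ) : rowCount s i = rowCount t i := by
  -- The length of `M/pʳM` is `truncSum s r`, and these numbers determine the rows.
  refine rowCount_eq_of_truncSum_eq (fun r => ?_) i
  have h := ((hs.quotient_pow r).length_eq hp).symm.trans ((ht.quotient_pow r).length_eq hp)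
  exact_mod_cast h

end HasType

/-! ### Cokernels of poles -/

section Poles

variable {Λ : Type u} [CommRing Λ] (p : Λ)

/-- Splitting off the component of smallest height from the cokernel of a cyclic embedding. -/
lemma nonempty_quotient_span_prod_equiv {C : Type u} [AddCommGroup C] [Module Λ C] (c : C)
    (x l i : ℕ) :
    Nonempty ((((Λ ⧸ Ideal.span {p ^ (x + l)}) × C) ⧸
        Submodule.span Λ {p ^ i • ((Submodule.Quotient.mk (p ^ x), p ^ x • c) :
          (Λ ⧸ Ideal.span {p ^ (x + l)}) × C)}) ≃ₗ[Λ]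
      (Λ ⧸ Ideal.span {p ^ (x + min i l)}) ×
        (C ⧸ Submodule.span Λ {p ^ max i l • p ^ x • c})) := by
  let q := quotientPowMap p (show x + min i l ≤ x + l by omega)
  have hq : Function.Surjective q := quotientPowMap_surjective _
  let W := Submodule.span Λ {p ^ max i l • p ^ x • c}
  rcases le_total l i with h | h
  -- For `l ≤ i` the first coordinate of the relation is zero, so the quotient splits as it stands.
  · refine Submodule.nonempty_quotient_equiv (LinearMap.prodMap q W.mkQ)
      (Function.Surjective.prodMap hq W.mkQ_surjective) ?_
    rintro ⟨s, v⟩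
    obtain ⟨s, rfl⟩ := Submodule.Quotient.mk_surjective _ s
    rw [LinearMap.prodMap_apply, Prod.mk_eq_zero, Submodule.mkQ_apply,
      Submodule.Quotient.mk_eq_zero, Submodule.mem_span_singleton, Submodule.mem_span_singleton,
      quotientPowMap_mk, mk_eq_zero_iff_dvd, min_eq_right h, max_eq_left h]
    have h0 : ∀ a : Λ, (Submodule.Quotient.mk (a * p ^ i * p ^ x) :
        Λ ⧸ Ideal.span {p ^ (x + l)}) = 0 := fun a =>
      (mk_eq_zero_iff_dvd _ _).2 (by
        rw [mul_assoc, ← pow_add]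
        exact (pow_dvd_pow p (by omega)).mul_left a)
    have h1 : ∀ a : Λ, a • p ^ i • ((Submodule.Quotient.mk (p ^ x), p ^ x • c) :
        (Λ ⧸ Ideal.span {p ^ (x + l)}) × C) = (0, a • p ^ i • p ^ x • c) := by
      intro a
      rw [Prod.smul_mk, Prod.smul_mk, ← Submodule.Quotient.mk_smul, ← Submodule.Quotient.mk_smul,
        smul_eq_mul, smul_eq_mul, ← mul_assoc, h0]
    simp only [h1, Prod.mk.injEq]
    constructor
    · rintro ⟨hs, a, ha⟩
      exact ⟨a, ((mk_eq_zero_iff_dvd _ _).2 hs).symm, ha⟩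
    · rintro ⟨a, hs, ha⟩
      exact ⟨(mk_eq_zero_iff_dvd _ _).1 hs.symm, a, ha⟩
  -- For `i ≤ l` use the shear `(s, v) ↦ (s, v - s • c)`, which sends the relation into the first
  -- factor. It is well defined only modulo `p ^ (x + l) • c`, which is the generator of `W`.
  · let g : (Λ ⧸ Ideal.span {p ^ (x + l)}) →ₗ[Λ] C ⧸ W :=
      Submodule.liftQ _ (W.mkQ ∘ₗ LinearMap.toSpanSingleton Λ C c) (by
        rw [Ideal.span, Submodule.span_le, Set.singleton_subset_iff]
        change W.mkQ (p ^ (x + l) • c) = 0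
        rw [Submodule.mkQ_apply, Submodule.Quotient.mk_eq_zero, add_comm, pow_add, mul_smul,
          ← max_eq_right h]
        exact Submodule.mem_span_singleton_self _)
    have hg : ∀ t : Λ, g (Submodule.Quotient.mk t) = Submodule.Quotient.mk (t • c) := fun _ => rfl
    refine Submodule.nonempty_quotient_equiv
      (LinearMap.prod (q ∘ₗ LinearMap.fst Λ _ _)
        (W.mkQ ∘ₗ LinearMap.snd Λ _ _ - g ∘ₗ LinearMap.fst Λ _ _)) ?_ ?_
    · rintro ⟨a, b⟩
      obtain ⟨s, rfl⟩ := hq a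
      obtain ⟨v, rfl⟩ := W.mkQ_surjective b
      obtain ⟨t, rfl⟩ := Submodule.Quotient.mk_surjective _ s
      refine ⟨(Submodule.Quotient.mk t, v + t • c), ?_⟩
      ext
      · rfl
      · change W.mkQ (v + t • c) - g (Submodule.Quotient.mk t) = W.mkQ v
        rw [hg, map_add, Submodule.mkQ_apply, Submodule.mkQ_apply]
        abel
    · rintro ⟨s, v⟩
      obtain ⟨s, rfl⟩ := Submodule.Quotient.mk_surjective _ s
      change (q (Submodule.Quotient.mk s), W.mkQ v - g (Submodule.Quotient.mk s)) = 0 ↔ _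
      rw [Prod.mk_eq_zero, hg, Submodule.mkQ_apply, ← Submodule.Quotient.mk_sub,
        Submodule.Quotient.mk_eq_zero, Submodule.mem_span_singleton, Submodule.mem_span_singleton,
        quotientPowMap_mk, mk_eq_zero_iff_dvd, min_eq_left h, max_eq_right h]
      have h1 : ∀ a : Λ, a • p ^ i • ((Submodule.Quotient.mk (p ^ x), p ^ x • c) :
          (Λ ⧸ Ideal.span {p ^ (x + l)}) × C) =
          (Submodule.Quotient.mk (a * p ^ i * p ^ x), (a * p ^ i * p ^ x) • c) := by
        intro a
        rw [Prod.smul_mk, Prod.smul_mk, ← Submodule.Quotient.mk_smul,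
          ← Submodule.Quotient.mk_smul, smul_eq_mul, smul_eq_mul, ← mul_assoc, mul_smul, mul_smul]
      simp only [h1, Prod.mk.injEq, smul_smul]
      constructor
      · rintro ⟨⟨t, rfl⟩, w, hw⟩
        refine ⟨t + w * p ^ (l - i), ?_, ?_⟩
        · rw [← sub_eq_zero, ← Submodule.Quotient.mk_sub, mk_eq_zero_iff_dvd]
          refine ⟨w, ?_⟩
          obtain ⟨k, rfl⟩ := Nat.exists_eq_add_of_le h
          rw [Nat.add_sub_cancel_left]
          ring
        · rw [eq_add_of_sub_eq hw.symm, ← add_smul]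
          congr 1
          obtain ⟨k, rfl⟩ := Nat.exists_eq_add_of_le h
          rw [Nat.add_sub_cancel_left]
          ring
      · rintro ⟨a, hs, rfl⟩
        rw [← sub_eq_zero, ← Submodule.Quotient.mk_sub, mk_eq_zero_iff_dvd] at hs
        obtain ⟨w, hw⟩ := hs
        obtain ⟨k, rfl⟩ := Nat.exists_eq_add_of_le h
        have hs : s = a * p ^ i * p ^ x - p ^ (x + (i + k)) * w := by rw [← hw]; ring
        refine ⟨⟨a - p ^ k * w, ?_⟩, w, ?_⟩
        · rw [hs]; ring
        · rw [← sub_smul, hs]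
          congr 1
          ring

/-- The element `(p ^ x)` of `⨁ Λ/(p ^ (x + l))`. -/
def poleGenerator {n : ℕ} (x l : Fin n → ℕ) : (k : Fin n) → Λ ⧸ Ideal.span {p ^ (x k + l k)} :=
  fun k => Submodule.Quotient.mk (p ^ x k)

/-- Monotonicity makes the remaining coordinates of the generator divisible by `p ^ x 0`, as needed
to split off the first one; the tail is then taken at level `max i (l 0)`, matching the recursion of
`poleHeights`. -/
lemma hasType_quotient_poleGenerator {n : ℕ} (x l : Fin n → ℕ) (hx : Monotone x) (i : ℕ) :
    HasType p (((k : Fin n) → Λ ⧸ Ideal.span {p ^ (x k + l k)}) ⧸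
        Submodule.span Λ {p ^ i • poleGenerator p x l})
      (poleHeights (List.ofFn fun k => (x k, l k)) i) := by
  induction n generalizing i with
  | zero => exact hasType_of_subsingleton
  | succ n ih =>
    let c : (k : Fin n) → Λ ⧸ Ideal.span {p ^ (x k.succ + l k.succ)} :=
      fun k => Submodule.Quotient.mk (p ^ (x k.succ - x 0))
    have hc : p ^ x 0 • c = poleGenerator p (fun k => x k.succ) (fun k => l k.succ) := by
      ext k
      rw [Pi.smul_apply, ← Submodule.Quotient.mk_smul, smul_eq_mul, ← pow_add,
        Nat.add_sub_cancel' (hx (Fin.zero_le _)), poleGenerator]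
    let e := Fin.consLinearEquiv Λ (fun k : Fin (n + 1) => Λ ⧸ Ideal.span {p ^ (x k + l k)})
    have he : e (Submodule.Quotient.mk (p ^ x 0), p ^ x 0 • c) = poleGenerator p x l := by
      rw [hc]
      ext k
      refine Fin.cases ?_ (fun k => ?_) k <;> rfl
    obtain ⟨f⟩ := nonempty_quotient_span_prod_equiv p c (x 0) (l 0) i
    have htail := ih (fun k => x k.succ) (fun k => l k.succ)
      (fun a b hab => hx (Fin.succ_le_succ_iff.2 hab)) (max i (l 0))
    rw [← hc] at htail
    have := ((hasType_quotient p (x 0 + min i (l 0))).prod htail).of_equiv f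
    rw [List.ofFn_succ, poleHeights, ← Multiset.singleton_add]
    refine this.of_equiv (Submodule.Quotient.equiv _ _ e ?_).symm
    rw [Submodule.map_span, Set.image_singleton, LinearEquiv.coe_coe, map_smul, he]

lemma pow_poleOrder_dvd_iff (L : List (ℕ × ℕ)) (t : Λ) :
    p ^ poleOrder L ∣ t ↔ ∀ c ∈ L, p ^ c.2 ∣ t := by
  induction L with
  | nil => simp
  | cons c L ih =>
    rw [poleOrder_cons, List.forall_mem_cons, ← ih]
    rcases le_total c.2 (poleOrder L) with h | h
    · rw [max_eq_right h]
      exact ⟨fun H => ⟨(pow_dvd_pow p h).trans H, H⟩, And.right⟩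
    · rw [max_eq_left h]
      exact ⟨fun H => ⟨H, (pow_dvd_pow p h).trans H⟩, And.left⟩

lemma smul_poleGenerator_eq_zero_iff [IsDomain Λ] (hp : p ≠ 0) {n : ℕ} (x l : Fin n → ℕ) (t : Λ) :
    t • poleGenerator p x l = 0 ↔ p ^ poleOrder (List.ofFn fun k => (x k, l k)) ∣ t := by
  rw [pow_poleOrder_dvd_iff, List.forall_mem_ofFn_iff, funext_iff]
  refine forall_congr' fun k => ?_
  rw [Pi.smul_apply, poleGenerator, ← Submodule.Quotient.mk_smul, Pi.zero_apply,
    mk_eq_zero_iff_dvd, smul_eq_mul, add_comm, pow_add, mul_dvd_mul_iff_right (pow_ne_zero _ hp)]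

lemma hasType_poles {n : ℕ} (x l : Fin n → ℕ) :
    HasType p ((k : Fin n) → Λ ⧸ Ideal.span {p ^ (x k + l k)})
      ((List.ofFn fun k => (x k, l k)).map fun c => c.1 + c.2 : List ℕ) := by
  convert hasType_pi_quotient p fun k => x k + l k
  rw [List.map_ofFn, ← Multiset.sum_map_singleton ((List.ofFn _ : List ℕ) : Multiset ℕ),
    Multiset.map_coe, Multiset.sum_coe, List.map_ofFn, List.sum_ofFn]
  rfl

end Poles

/-! ### Realizing poles by embeddings -/

lemma DirectSum.isInternal_range_single {R M : Type*} [Ring R] [AddCommGroup M] [Module R M]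
    {κ : Type*} [Fintype κ] [DecidableEq κ] {N : κ → Type*} [∀ k, AddCommGroup (N k)]
    [∀ k, Module R (N k)] (e : ((k : κ) → N k) ≃ₗ[R] M) :
    DirectSum.IsInternal fun k => LinearMap.range (e.toLinearMap ∘ₗ LinearMap.single R N k) := by
  refine DirectSum.isInternal_submodule_of_iSupIndep_of_iSup_eq_top ?_ ?_
  · intro k
    rw [Submodule.disjoint_def]
    rintro _ ⟨n, rfl⟩ hn
    have hle : (⨆ j, ⨆ (_ : j ≠ k), LinearMap.range (e.toLinearMap ∘ₗ LinearMap.single R N j)) ≤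
        LinearMap.ker (LinearMap.proj k ∘ₗ e.symm.toLinearMap) := by
      refine iSup₂_le fun j hj => ?_
      rintro _ ⟨a, rfl⟩
      simp [LinearMap.mem_ker, hj.symm]
    have := hle hn
    simp only [LinearMap.mem_ker, LinearMap.comp_apply, LinearEquiv.coe_coe,
      LinearEquiv.symm_apply_apply, LinearMap.coe_single, LinearMap.proj_apply,
      Pi.single_eq_same] at this
    rw [this, map_zero]
  · rw [eq_top_iff]
    rintro x -
    rw [← e.apply_symm_apply x, ← Finset.univ_sum_single (e.symm x), map_sum]
    exact Submodule.sum_mem _ fun k _ => Submodule.mem_iSup_of_mem k ⟨e.symm x k, rfl⟩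

section Embedding

variable {Λ : Type u} [CommRing Λ] (p : Λ)

lemma pow_poleOrder_smul_poleGenerator {Λ : Type u} [CommRing Λ] (p : Λ) {n : ℕ}
    (x l : Fin n → ℕ) :
    p ^ poleOrder (List.ofFn fun k => (x k, l k)) • poleGenerator p x l = 0 := by
  ext k
  rw [Pi.smul_apply, poleGenerator, ← Submodule.Quotient.mk_smul, Pi.zero_apply,
    mk_eq_zero_iff_dvd, smul_eq_mul, add_comm, pow_add]
  exact mul_dvd_mul_right ((pow_poleOrder_dvd_iff p _ _).1 dvd_rfl (x k, l k)
    ((List.mem_ofFn' _ _).2 ⟨k, rfl⟩)) _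

/-- The cyclic embedding generated by `(p ^ x)` in `⨁ Λ/(p ^ (x + l))`. -/
def poleMap {n : ℕ} (x l : Fin n → ℕ) :
    (Λ ⧸ Ideal.span {p ^ poleOrder (List.ofFn fun k => (x k, l k))}) →ₗ[Λ]
      ((k : Fin n) → Λ ⧸ Ideal.span {p ^ (x k + l k)}) :=
  Submodule.liftQ _ (LinearMap.toSpanSingleton Λ _ (poleGenerator p x l)) (by
    rw [Ideal.span, Submodule.span_le, Set.singleton_subset_iff]
    exact pow_poleOrder_smul_poleGenerator p x l)

variable {p}

lemma poleMap_mk {n : ℕ} (x l : Fin n → ℕ) (t : Λ) :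
    poleMap p x l (Submodule.Quotient.mk t) = t • poleGenerator p x l := rfl

lemma poleMap_injective [IsDomain Λ] (hp : p ≠ 0) {n : ℕ} (x l : Fin n → ℕ) :
    Function.Injective (poleMap p x l) := by
  rw [injective_iff_map_eq_zero]
  intro a ha
  obtain ⟨t, rfl⟩ := Submodule.Quotient.mk_surjective _ a
  rwa [poleMap_mk, smul_poleGenerator_eq_zero_iff p hp, ← mk_eq_zero_iff_dvd] at ha

/-- Every arrangement of a tableau as the tableau of a direct sum of cyclic embeddings is
realized by such an embedding. -/
lemma exists_embedding_of_poles [IsDomain Λ] (hp : p ≠ 0) {α β γ : YoungDiagram} {Γ : Tableau}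
    (hshape : Γ.HasShape β γ) (hcontent : Γ.HasContent α) {m : ℕ} (L : Fin m → List (ℕ × ℕ))
    (hL : ∀ k, (L k).Pairwise fun c d => c.1 ≤ d.1)
    (hΓ : ∀ i, partitionParts (Γ.part i) = (∑ k, poleHeights (L k) i).filter (0 < ·)) :
    ∃ f : NMod p α →ₗ[Λ] NMod p β, IsCyclicSumEmbeddingOfType p α β γ f ∧ IsTableauOf p f Γ := by
  let x : (k : Fin m) → Fin (L k).length → ℕ := fun k j => ((L k).get j).1
  let l : (k : Fin m) → Fin (L k).length → ℕ := fun k j => ((L k).get j).2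
  have hofFn : ∀ k, (List.ofFn fun j => (x k j, l k j)) = L k := fun k => List.ofFn_get (L k)
  have hx : ∀ k, Monotone (x k) := by
    intro k i j hij
    rcases eq_or_lt_of_le hij with rfl | hlt
    · exact le_rfl
    · exact List.pairwise_iff_get.1 (hL k) i j hlt
  let A : Fin m → Type u := fun k =>
    Λ ⧸ Ideal.span {p ^ poleOrder (List.ofFn fun j => (x k j, l k j))}
  let B : Fin m → Type u := fun k => (j : Fin (L k).length) → Λ ⧸ Ideal.span {p ^ (x k j + l k j)}
  have hA : HasType p ((k : Fin m) → A k) (∑ k, {poleOrder (L k)}) := by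
    have := HasType.pi fun k =>
      hasType_quotient p (poleOrder (List.ofFn fun j => (x k j, l k j)))
    simpa only [hofFn] using this
  have hB : HasType p ((k : Fin m) → B k) (∑ k, ((L k).map fun c => c.1 + c.2 : Multiset ℕ)) := by
    have := HasType.pi fun k => hasType_poles p (x k) (l k)
    simpa only [hofFn] using this
  obtain ⟨eA⟩ := hA.nonempty_equiv_NMod ((Tableau.hasContent_of_poles L hΓ).1 hcontent)
  obtain ⟨eB⟩ := hB.nonempty_equiv_NMod (α := β) (by
    obtain ⟨r, hr⟩ := hshape.2
    rw [← partitionParts_eq_iff, ← hr _ (le_max_left r (∑ k, poleOrder (L k))), hΓ]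
    congr 1
    refine Finset.sum_congr rfl fun k _ => poleHeights_of_le _ (le_max_of_le_right ?_)
    exact Finset.single_le_sum (fun k _ => Nat.zero_le (poleOrder (L k))) (Finset.mem_univ k))
  let g : ((k : Fin m) → A k) →ₗ[Λ] ((k : Fin m) → B k) :=
    LinearMap.piMap fun k => poleMap p (x k) (l k)
  have hg : ∀ a k, g a k = poleMap p (x k) (l k) (a k) := fun _ _ => rfl
  let f : NMod p α →ₗ[Λ] NMod p β := eB.toLinearMap ∘ₗ g ∘ₗ eA.symm.toLinearMap
  have hf : ∀ a, f (eA a) = eB (g a) := fun a => by simp [f]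
  have htab : IsTableauOf p f Γ := by
    intro i
    let q : (k : Fin m) → B k →ₗ[Λ] (B k ⧸ Submodule.span Λ {p ^ i • poleGenerator p (x k) (l k)}) :=
      fun k => Submodule.mkQ _
    obtain ⟨e⟩ := Submodule.nonempty_quotient_equiv (LinearMap.piMap q ∘ₗ eB.symm.toLinearMap)
      ((Function.Surjective.piMap fun k => Submodule.mkQ_surjective
        (Submodule.span Λ {p ^ i • poleGenerator p (x k) (l k)})).comp eB.symm.surjective)
      (S := LinearMap.range (p ^ i • f)) (by
        intro b
        obtain ⟨b, rfl⟩ := eB.surjective b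
        have h1 : (LinearMap.piMap q ∘ₗ eB.symm.toLinearMap) (eB b) = fun k => q k (b k) := by
          ext k
          simp
        rw [h1, funext_iff]
        constructor
        · intro h
          have : ∀ k, ∃ t : Λ, t • p ^ i • poleGenerator p (x k) (l k) = b k := fun k =>
            Submodule.mem_span_singleton.1 ((Submodule.Quotient.mk_eq_zero _).1 (h k))
          choose t ht using this
          refine ⟨eA fun k => Submodule.Quotient.mk (t k), ?_⟩
          rw [LinearMap.smul_apply, hf, ← map_smul]
          congr 1
          ext1 k
          rw [Pi.smul_apply, hg, poleMap_mk, smul_comm, ht]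
        · rintro ⟨a, ha⟩ k
          obtain ⟨a, rfl⟩ := eA.surjective a
          rw [LinearMap.smul_apply, hf, ← map_smul, eB.injective.eq_iff] at ha
          refine (Submodule.Quotient.mk_eq_zero _).2 (Submodule.mem_span_singleton.2 ?_)
          obtain ⟨t, ht⟩ := Submodule.Quotient.mk_surjective _ (a k)
          refine ⟨t, ?_⟩
          rw [← ha, Pi.smul_apply, hg, ← ht, poleMap_mk, smul_comm])
    have htype := HasType.pi fun k => hasType_quotient_poleGenerator p (x k) (l k) (hx k) i
    simp only [hofFn] at htype
    exact (htype.of_equiv e).nonempty_equiv_NMod (partitionParts_eq_iff.1 (hΓ i))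
  refine ⟨f, ⟨?_, ?_, ?_⟩, htab⟩
  · exact eB.injective.comp ((Function.Injective.piMap fun k =>
      poleMap_injective hp (x k) (l k)).comp eA.symm.injective)
  -- The cokernel is the level `i = 0` of the tableau.
  · have := htab 0
    rwa [pow_zero, one_smul, hshape.1] at this
  · refine ⟨m, _, _, DirectSum.isInternal_range_single eA, DirectSum.isInternal_range_single eB,
      fun k => ⟨?_, ?_⟩⟩
    · rintro _ ⟨_, ⟨a, rfl⟩, rfl⟩
      refine ⟨poleMap p (x k) (l k) a, ?_⟩
      change eB (Pi.single k (poleMap p (x k) (l k) a)) = f (eA (Pi.single k a))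
      rw [hf]
      congr 1
      ext1 j
      rw [hg]
      by_cases hj : j = k
      · subst hj
        simp
      · simp [hj]
    · refine ⟨eA (Pi.single k (Submodule.Quotient.mk 1)), le_antisymm ?_ ?_⟩
      · rintro _ ⟨a, rfl⟩
        obtain ⟨t, rfl⟩ := Submodule.Quotient.mk_surjective _ a
        refine Submodule.mem_span_singleton.2 ⟨t, ?_⟩
        rw [← map_smul, ← Pi.single_smul, ← Submodule.Quotient.mk_smul, smul_eq_mul, mul_one]
        rfl
      · rw [Submodule.span_le, Set.singleton_subset_iff]
        exact ⟨Submodule.Quotient.mk 1, rfl⟩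

end Embedding

/-! ### From cyclic embeddings to poles -/

lemma DirectSum.IsInternal.exists_pi_equiv {R M : Type*} [Ring R] [AddCommGroup M] [Module R M]
    {κ : Type*} [Fintype κ] [DecidableEq κ] {N : κ → Submodule R M} (h : DirectSum.IsInternal N) :
    ∃ e : ((k : κ) → N k) ≃ₗ[R] M, ∀ b, e b = ∑ k, (b k : M) := by
  let e := (DirectSum.linearEquivFunOnFintype R κ fun k => N k).symm.trans
    (LinearEquiv.ofBijective (DirectSum.coeLinearMap N) h)
  refine ⟨e, fun b => ?_⟩
  conv_lhs => rw [← Finset.univ_sum_single b, map_sum]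
  refine Finset.sum_congr rfl fun k _ => ?_
  rw [LinearEquiv.trans_apply, DirectSum.linearEquivFunOnFintype_symm_single]
  exact DirectSum.coeLinearMap_lof N k (b k)

section Structure

variable {Λ : Type u} [CommRing Λ] [IsDomain Λ] [IsDiscreteValuationRing Λ] {p : Λ}

lemma exists_unit_smul_eq_mk_pow (hp : Irreducible p) (n : ℕ) (c : Λ ⧸ Ideal.span {p ^ n}) :
    ∃ (x l : ℕ) (u : Λˣ), n = x + l ∧ (u : Λ) • c = Submodule.Quotient.mk (p ^ x) := by
  obtain ⟨t, rfl⟩ := Submodule.Quotient.mk_surjective _ c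
  have hzero : p ^ n ∣ t → ∃ (x l : ℕ) (u : Λˣ), n = x + l ∧
      (u : Λ) • (Submodule.Quotient.mk t : Λ ⧸ Ideal.span {p ^ n}) =
        Submodule.Quotient.mk (p ^ x) := by
    intro h
    -- The zero class is represented by `p ^ n`, so it gets `l = 0` and contributes nothing to the
    -- order.
    refine ⟨n, 0, 1, rfl, ?_⟩
    rw [(mk_eq_zero_iff_dvd _ _).2 h, (mk_eq_zero_iff_dvd _ _).2 dvd_rfl, smul_zero]
  rcases eq_or_ne t 0 with rfl | ht
  · exact hzero (dvd_zero _)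
  · obtain ⟨x, u, rfl⟩ := IsDiscreteValuationRing.eq_unit_mul_pow_irreducible ht hp
    rcases le_total n x with h | h
    · exact hzero ((pow_dvd_pow p h).mul_left _)
    · refine ⟨x, n - x, u⁻¹, by omega, ?_⟩
      rw [← Submodule.Quotient.mk_smul, smul_eq_mul, Units.inv_mul_cancel_left]

/-- Every element of a finite length module is, in suitable coordinates, of the form `(p ^ x)`. -/
lemma exists_equiv_poleGenerator (hp : Irreducible p) {B : Type u} [AddCommGroup B] [Module Λ B]
    [Module.Finite Λ B] (hB : ∀ b : B, ∃ n : ℕ, p ^ n • b = 0) (b : B) :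
    ∃ (n : ℕ) (x l : Fin n → ℕ), Monotone x ∧
      ∃ e : B ≃ₗ[Λ] ((k : Fin n) → Λ ⧸ Ideal.span {p ^ (x k + l k)}), e b = poleGenerator p x l := by
  obtain ⟨n, h, ⟨e⟩⟩ := Module.torsion_by_prime_power_decomposition hp
    ((Submodule.isTorsion'_powers_iff p).2 hB)
  let e' : B ≃ₗ[Λ] ((k : Fin n) → Λ ⧸ Ideal.span {p ^ h k}) :=
    e.trans (DirectSum.linearEquivFunOnFintype Λ (Fin n) _)
  choose x l u hxl hu using fun k => exists_unit_smul_eq_mk_pow hp (h k) (e' b k)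
  obtain rfl : h = fun k => x k + l k := funext hxl
  let σ := Tuple.sort x
  refine ⟨n, x ∘ σ, l ∘ σ, Tuple.monotone_sort x,
    (e'.trans (LinearEquiv.piCongrRight fun k => LinearEquiv.smulOfUnit (u k))).trans
      (LinearEquiv.piCongrLeft Λ (fun k => Λ ⧸ Ideal.span {p ^ (x k + l k)}) σ).symm, ?_⟩
  ext k
  exact hu (σ k)

lemma NMod.pow_smul_eq_zero {Λ : Type u} [CommRing Λ] (p : Λ) (α : YoungDiagram) (b : NMod p α) :
    p ^ α.colLen 0 • b = 0 := by
  ext j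
  obtain ⟨t, ht⟩ := Submodule.Quotient.mk_surjective _ (b j)
  rw [Pi.smul_apply, ← ht, ← Submodule.Quotient.mk_smul, Pi.zero_apply, mk_eq_zero_iff_dvd]
  exact (pow_dvd_pow p (α.colLen_anti 0 j (Nat.zero_le _))).mul_right t

/-- The cokernel of a direct sum of cyclic embeddings. -/
lemma nonempty_quotient_range_equiv {Λ : Type u} [CommRing Λ] {M N : Type*} [AddCommGroup M]
    [Module Λ M] [AddCommGroup N] [Module Λ N] {f : M →ₗ[Λ] N} {κ : Type*} [Fintype κ]
    [DecidableEq κ] {A : κ → Submodule Λ M} {B : κ → Submodule Λ N}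
    (hA : DirectSum.IsInternal A) (hB : DirectSum.IsInternal B) {a : κ → M}
    (ha : ∀ k, A k = Submodule.span Λ {a k}) (haB : ∀ k, f (a k) ∈ B k) :
    Nonempty ((N ⧸ LinearMap.range f) ≃ₗ[Λ]
      ((k : κ) → B k ⧸ Submodule.span Λ {(⟨f (a k), haB k⟩ : B k)})) := by
  obtain ⟨eA, heA⟩ := hA.exists_pi_equiv
  obtain ⟨eB, heB⟩ := hB.exists_pi_equiv
  let q : (k : κ) → B k →ₗ[Λ] (B k ⧸ Submodule.span Λ {(⟨f (a k), haB k⟩ : B k)}) :=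
    fun k => Submodule.mkQ _
  exact Submodule.nonempty_quotient_equiv (LinearMap.piMap q ∘ₗ eB.symm.toLinearMap)
    ((Function.Surjective.piMap fun k => Submodule.mkQ_surjective
      (Submodule.span Λ {(⟨f (a k), haB k⟩ : B k)})).comp eB.symm.surjective)
    (S := LinearMap.range f) (by
      intro b
      obtain ⟨b, rfl⟩ := eB.surjective b
      have h1 : (LinearMap.piMap q ∘ₗ eB.symm.toLinearMap) (eB b) = fun k => q k (b k) := by
        ext k
        simp
      rw [h1, funext_iff]
      constructor
      · intro h
        have : ∀ k, ∃ t : Λ, t • (⟨f (a k), haB k⟩ : B k) = b k := fun k =>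
          Submodule.mem_span_singleton.1 ((Submodule.Quotient.mk_eq_zero _).1 (h k))
        choose t ht using this
        refine ⟨∑ k, t k • a k, ?_⟩
        rw [heB, map_sum]
        refine Finset.sum_congr rfl fun k _ => ?_
        rw [← ht, map_smul, Submodule.coe_smul]
      · rintro ⟨y, hy⟩ k
        obtain ⟨y, rfl⟩ := eA.surjective y
        have : ∀ k, ∃ t : Λ, t • a k = y k := fun k =>
          Submodule.mem_span_singleton.1 (ha k ▸ (y k).2)
        choose t ht using this
        have hb : eB b = eB fun k => t k • ⟨f (a k), haB k⟩ := by
          rw [← hy, heA, map_sum, heB]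
          refine Finset.sum_congr rfl fun k _ => ?_
          rw [← ht, map_smul, Submodule.coe_smul]
        rw [eB.injective hb]
        exact (Submodule.Quotient.mk_eq_zero _).2
          (Submodule.mem_span_singleton.2 ⟨t k, rfl⟩))

lemma hasType_of_principal {Λ : Type u} [CommRing Λ] {p : Λ} {M : Type u} [AddCommGroup M]
    [Module Λ M] {A : Submodule Λ M} {a : M} (ha : A = Submodule.span Λ {a}) {n : ℕ}
    (h : ∀ t : Λ, t • a = 0 ↔ p ^ n ∣ t) : HasType p A {n} := by
  subst ha
  obtain ⟨g⟩ := Submodule.nonempty_quotient_equiv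
    (LinearMap.toSpanSingleton Λ (Submodule.span Λ {a}) ⟨a, Submodule.mem_span_singleton_self a⟩)
    (S := Ideal.span {p ^ n}) (by
      rintro ⟨y, hy⟩
      obtain ⟨t, rfl⟩ := Submodule.mem_span_singleton.1 hy
      exact ⟨t, rfl⟩) (by
      intro t
      rw [Ideal.mem_span_singleton, ← h, ← Submodule.coe_eq_zero]
      rfl)
  exact (hasType_quotient p n).of_equiv g.symm

/-- The types of the modules in a direct sum of cyclic embeddings. -/
lemma IsDirectSumOfCyclicEmbeddings.exists_poles (hp : Irreducible p) {M N : Type u}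
    [AddCommGroup M] [Module Λ M] [AddCommGroup N] [Module Λ N] [IsNoetherian Λ N]
    (hN : ∀ b : N, ∃ n : ℕ, p ^ n • b = 0) {f : M →ₗ[Λ] N} (hinj : Function.Injective f)
    (hf : IsDirectSumOfCyclicEmbeddings f) :
    ∃ (m : ℕ) (L : Fin m → List (ℕ × ℕ)), (∀ k, (L k).Pairwise fun c d => c.1 ≤ d.1) ∧
      HasType p M (∑ k, {poleOrder (L k)}) ∧
      HasType p N (∑ k, ((L k).map fun c => c.1 + c.2 : Multiset ℕ)) ∧
      HasType p (N ⧸ LinearMap.range f) (∑ k, poleHeights (L k) 0) := by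
  obtain ⟨m, A, B, hA, hB, hAB⟩ := hf
  choose a ha using fun k => (hAB k).2.principal
  have haB : ∀ k, f (a k) ∈ B k := fun k =>
    (hAB k).1 ⟨a k, by rw [ha k]; exact Submodule.mem_span_singleton_self _, rfl⟩
  -- Each `B k` is put into coordinates adapted to the image of the generator of `A k`.
  have hpole := fun k => exists_equiv_poleGenerator hp (B := B k) (fun b =>
    (hN b).imp fun n hn => Subtype.ext hn) ⟨f (a k), haB k⟩
  choose n x l hx e he using hpole
  obtain ⟨eA, -⟩ := hA.exists_pi_equiv
  obtain ⟨eB, -⟩ := hB.exists_pi_equiv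
  obtain ⟨g⟩ := nonempty_quotient_range_equiv hA hB ha haB
  refine ⟨m, fun k => List.ofFn fun j => (x k j, l k j),
    fun k => List.pairwise_ofFn.2 fun i j hij => hx k hij.le,
    (HasType.pi fun k => hasType_of_principal (ha k) fun t => ?_).of_equiv eA.symm,
    (HasType.pi fun k => (hasType_poles p (x k) (l k)).of_equiv (e k)).of_equiv eB.symm,
    (HasType.pi fun k => (hasType_quotient_poleGenerator p (x k) (l k) (hx k) 0).of_equiv
      (Submodule.Quotient.equiv _ _ (e k) ?_)).of_equiv g⟩
  · rw [← smul_poleGenerator_eq_zero_iff p hp.ne_zero, ← he, ← map_smul,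
      LinearEquiv.map_eq_zero_iff, ← Submodule.coe_eq_zero, Submodule.coe_smul, ← map_smul,
      map_eq_zero_iff f hinj]
  · rw [Submodule.map_span, Set.image_singleton, LinearEquiv.coe_coe, he, pow_zero, one_smul]

/-- The poles give types of source, target and cokernel; by uniqueness of types these are `α`, `β`,
`γ`, which identifies content and shape of `ofPoles L`. -/
lemma exists_tableau_of_embedding (hp : Irreducible p) {α β γ : YoungDiagram}
    {f : NMod p α →ₗ[Λ] NMod p β} (hf : IsCyclicSumEmbeddingOfType p α β γ f) :
    ∃ Γ : Tableau, Γ.IsLR ∧ Γ.HasShape β γ ∧ Γ.HasContent α ∧ Γ.IsUnionOfColumns := by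
  obtain ⟨hinj, ⟨coker⟩, hsum⟩ := hf
  obtain ⟨m, L, hL, hα, hβ, hγ⟩ := hsum.exists_poles hp
    (fun b => ⟨β.colLen 0, NMod.pow_smul_eq_zero p β b⟩) hinj
  have hα' := fun i => (hasType_NMod α).rowCount_eq hp hα i
  have hβ' := fun i => (hasType_NMod β).rowCount_eq hp hβ i
  have hγ' := fun i => (hasType_NMod γ).rowCount_eq hp (hγ.of_equiv coker.symm) i
  simp only [rowCount_partitionParts] at hα' hβ' hγ'
  have h1 : (Tableau.ofPoles L).HasContent α :=
    (Tableau.hasContent_of_poles L (Tableau.partitionParts_ofPoles L)).2 hα'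
  exact ⟨Tableau.ofPoles L, Tableau.isLR_ofPoles L hL, Tableau.hasShape_ofPoles L hβ' hγ', h1,
    Tableau.isUnionOfColumns_ofPoles L⟩

end Structure

/-! ### Horizontal strips -/

section HorizontalStrip

namespace Tableau

lemma le_of_hasShape {Γ : Tableau} {β γ : YoungDiagram} (h : Γ.HasShape β γ) (i : ℕ) :
    γ ≤ Γ.part i ∧ Γ.part i ≤ β := by
  obtain ⟨h0, r, hr⟩ := h
  refine ⟨h0 ▸ Γ.mono (Nat.zero_le i), ?_⟩
  rw [← hr _ (le_max_left r i)]
  exact Γ.mono (le_max_right r i)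

end Tableau

lemma YoungDiagram.colLen_mono {α β : YoungDiagram} (h : α ≤ β) (j : ℕ) :
    α.colLen j ≤ β.colLen j := by
  by_contra! hlt
  exact lt_irrefl _ (mem_iff_lt_colLen.1 (h (mem_iff_lt_colLen.2 hlt)))

lemma IsHorizontalStrip.colLen_le {β γ : YoungDiagram} (h : IsHorizontalStrip β γ) (j : ℕ) :
    β.colLen j ≤ γ.colLen j + 1 := by
  by_contra! hlt
  have := h.2 (γ.colLen j) (γ.colLen j + 1) j
  simp only [Finset.mem_sdiff, YoungDiagram.mem_cells, YoungDiagram.mem_iff_lt_colLen] at this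
  omega

/-- The geometric columns of `Γ` do the job: each contains at most one box, so its entries are
trivially consecutive. -/
lemma IsHorizontalStrip.isUnionOfColumns {β γ : YoungDiagram} (h : IsHorizontalStrip β γ)
    {Γ : Tableau} (hΓ : Γ.HasShape β γ) : Γ.IsUnionOfColumns := by
  have hcol : ∀ j, ∃ T : Tableau, T.IsColumn ∧ ∀ i, T.part i = singlePart ((Γ.part i).colLen j) := by
    intro j
    have h1 := fun i => YoungDiagram.colLen_mono (Tableau.le_of_hasShape hΓ i).1 j
    have h2 := fun i => YoungDiagram.colLen_mono (Tableau.le_of_hasShape hΓ i).2 j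
    have h3 := h.colLen_le j
    have hex : ∃ i, (Γ.part i).colLen j = β.colLen j := by
      obtain ⟨r, hr⟩ := hΓ.2
      exact ⟨r, by rw [hr r le_rfl]⟩
    classical
    -- The first level at which column `j` is full is the entry of its only box, or zero if the
    -- column has no box.
    rcases Nat.eq_zero_or_pos (Nat.find hex) with h0 | h0
    · have hγ := (Nat.find_eq_zero hex).1 h0
      rw [hΓ.1] at hγ
      refine ⟨Tableau.column 1 0 (β.colLen j), Or.inl ⟨_, rfl⟩, fun i => ?_⟩
      have := h1 i
      have := h2 i
      simp only [Tableau.column]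
      congr 1
      omega
    · have hγ := Nat.find_min hex h0
      rw [hΓ.1] at hγ
      have := h2 0
      rw [hΓ.1] at this
      refine ⟨Tableau.column (Nat.find hex) (Nat.find hex) (β.colLen j),
        Or.inr ⟨_, _, _, h0, le_rfl, by omega, rfl⟩, fun i => ?_⟩
      have := h1 i
      have := h2 i
      simp only [Tableau.column]
      congr 1
      rcases lt_or_ge i (Nat.find hex) with hi | hi
      · have := Nat.find_min hex hi
        omega
      · have h4 := YoungDiagram.colLen_mono (Γ.mono hi) j
        rw [Nat.find_spec hex] at h4
        omega
  choose C hC hpart using hcol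
  refine ⟨β.rowLen 0, fun j => C j, fun j => hC j, fun i => ?_⟩
  simp only [hpart, partitionParts_singlePart]
  rw [← multiset_filter_sum, partitionParts_eq_iff]
  intro r
  rw [← rowCount_map_colLen (Γ.part i)
    (YoungDiagram.le_iff_rowLen.1 (Tableau.le_of_hasShape hΓ i).2 0),
    Fin.sum_univ_eq_sum_range (fun j => ({(Γ.part i).colLen j} : Multiset ℕ)) (β.rowLen 0),
    ← Multiset.sum_map_singleton (Multiset.map _ _), Multiset.map_map]
  rfl

/-- The tableau of shape `β ∖ γ` all of whose entries are `1`. -/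
def Tableau.ofStrip {β γ : YoungDiagram} (h : γ ≤ β) : Tableau where
  part i := if i = 0 then γ else β
  mono i j hij := by
    dsimp only
    split_ifs with h1 h2
    · exact le_rfl
    · exact h
    · omega
    · exact le_rfl
  stable := ⟨1, fun i hi => by rw [if_neg (by omega), if_neg one_ne_zero]⟩

lemma IsHorizontalStrip.isLR_ofStrip {β γ : YoungDiagram} (h : IsHorizontalStrip β γ) :
    (Tableau.ofStrip h.1).IsLR := by
  have hempty : ∀ e, e ≠ 1 → (Tableau.ofStrip h.1).boxes e = ∅ := by
    intro e he
    rcases e with _ | _ | e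
    · simp [Tableau.boxes]
    · exact absurd rfl he
    · simp [Tableau.boxes, Tableau.ofStrip]
  have hone : ∀ {d c}, c ∈ (Tableau.ofStrip h.1).boxes d →
      d = 1 ∧ c ∈ β.cells \ γ.cells := by
    intro d c hc
    by_cases hd : d = 1
    · subst hd
      exact ⟨rfl, by simpa [Tableau.boxes, Tableau.ofStrip] using hc⟩
    · rw [hempty d hd] at hc
      simp at hc
  refine ⟨fun d e i j j' hd he _ => ((hone hd).1.trans (hone he).1.symm).le,
    fun d e i i' j hd he hi => absurd (h.2 i i' j (hone hd).2 (hone he).2) hi.ne,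
    fun e j he => ?_⟩
  rw [hempty (e + 1) (by omega)]
  simp

end HorizontalStrip

/-! ### The main theorem -/

theorem mainTheorem7 {Λ : Type u} [CommRing Λ] [IsDomain Λ] [IsDiscreteValuationRing Λ]
    (p : Λ) (hp : Irreducible p) (β γ : YoungDiagram) :
    (∀ α : YoungDiagram,
      (∃ f : NMod p α →ₗ[Λ] NMod p β, IsCyclicSumEmbeddingOfType p α β γ f) ↔
        ∃ Γ : Tableau, Γ.IsLR ∧ Γ.HasShape β γ ∧ Γ.HasContent α ∧ Γ.IsUnionOfColumns) ∧
    (IsHorizontalStrip β γ →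
      (∀ (α : YoungDiagram) (Γ : Tableau), Γ.IsLR → Γ.HasShape β γ → Γ.HasContent α →
        ∃ f : NMod p α →ₗ[Λ] NMod p β, IsCyclicSumEmbeddingOfType p α β γ f ∧
          IsTableauOf p f Γ) ∧
      ∃ (α : YoungDiagram) (f : NMod p α →ₗ[Λ] NMod p β),
        IsCyclicSumEmbeddingOfType p α β γ f) := by
  have key : ∀ (α : YoungDiagram) (Γ : Tableau), Γ.IsLR → Γ.HasShape β γ → Γ.HasContent α →
      Γ.IsUnionOfColumns → ∃ f : NMod p α →ₗ[Λ] NMod p β,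
        IsCyclicSumEmbeddingOfType p α β γ f ∧ IsTableauOf p f Γ := by
    intro α Γ hLR hshape hcontent hcol
    obtain ⟨m, L, hL, hΓ⟩ := hLR.exists_poles hcol
    exact exists_embedding_of_poles hp.ne_zero hshape hcontent L hL hΓ
  refine ⟨fun α => ⟨fun ⟨f, hf⟩ => exists_tableau_of_embedding hp hf, ?_⟩, fun hstrip => ⟨?_, ?_⟩⟩
  · rintro ⟨Γ, hLR, hshape, hcontent, hcol⟩
    obtain ⟨f, hf, -⟩ := key α Γ hLR hshape hcontent hcol
    exact ⟨f, hf⟩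
  · intro α Γ hLR hshape hcontent
    exact key α Γ hLR hshape hcontent (hstrip.isUnionOfColumns hshape)
  · have hshape : (Tableau.ofStrip hstrip.1).HasShape β γ :=
      ⟨rfl, 1, fun i hi => if_neg (by omega)⟩
    have hLR := hstrip.isLR_ofStrip
    obtain ⟨m, L, hL, hΓ⟩ := hLR.exists_poles (hstrip.isUnionOfColumns hshape)
    -- The partition `α` is read off from the poles: its positive parts are their nonzero orders.
    have hcontent : (Tableau.ofStrip hstrip.1).HasContent (ofParts (∑ k, {poleOrder (L k)})) :=
      (Tableau.hasContent_of_poles L hΓ).2 fun i => rowLen_ofParts _ i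
    obtain ⟨f, hf, -⟩ := exists_embedding_of_poles hp.ne_zero hshape hcontent L hL hΓ
    exact ⟨_, f, hf⟩
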